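/- Let $n\ge 2$ and let $\Gamma_1,\dots,\Gamma_n>0$ be the vorticities of $n$ planar point vortices with positions $z=(z_1,\dots,z_n)\in\mathbb R^{2n}$. Put $H(z)=-\sum_{i<j}\Gamma_i\Gamma_j\ln\|z_i-z_j\|$, $I(z)=\tfrac12\sum_i\Gamma_i\|z_i\|^2$, $M=\mathrm{diag}(\Gamma_1,\Gamma_1,\dots,\Gamma_n,\Gamma_n)$, $J=\begin{bmatrix}0&1\\-1&0\end{bmatrix}$, and let $K$ be the $2n\times 2n$ block diagonal matrix with diagonal blocks $J$. The vortices move according to $M\dot z=K\nabla H(z)$. A relative equilibrium with angular velocity $\omega\ne0$ is a collision-free configuration $z_0\in\mathbb R^{2n}$ such that the uniform rotation $z_i(t)=e^{-\omega Jt}z_{0,i}$ $(1\le i\le n)$ solves these equations. Its eigenvalues are the complex eigenvalues, with algebraic multiplicity, of the stability matrix $B=K(M^{-1}D^2H(z_0)+\omega\,\mathrm{Id})$; the four eigenvalues $0,0,\pm\omega i$ always occur and are called trivial, and the other $2n-4$ are called nontrivial. The relative equilibrium $z_0$ is * spectrally stable if all nontrivial eigenvalues are nonzero and purely imaginary; *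 linearly stable if, in addition, in some basis the restriction of $B$ to the $M$-orthogonal complement of $\mathrm{span}\{z_0,Kz_0\}$ is block diagonal with blocks $\begin{bmatrix}0&\beta_i\\-\beta_i&0\end{bmatrix}$, $\beta_i\in\mathbb R$; * nonlinearly stable if for every $\varepsilon>0$ there is $\delta>0$ such that every solution of the equations in rotating coordinates, $M\dot z=K(\nabla H(z)+\omega Mz)$, that starts within distance $\delta$ of $z_0$ remains within distance less than $\varepsilon$ of the circle $\gamma=\{e^{J\theta}z_0:\theta\in\mathbb R\}$ for all positive and negative times. Let $z_0$ be a relative equilibrium with angular velocity $\omega$ for which the points $z_{0,1},\dots,z_{0,n}$ lie on a line. Then: 1. $\nabla H(z_0)+\omega\nabla I(z_0)=0$, i.e. $z_0$ is a critical point of $H$ restricted to the level surface $S=\{I=I(z_0)\}$, and its Morse index is $n-2$: this is the largest dimension of a subspace of $T_{z_0}S=\{v:v^TMz_0=0\}$ on which the quadratic form $v\mapsto v^TD^2(H+\omega I)(z_0)\,v$ is negative definite. 2. The nontrivial eigenvalues, counted with multiplicity, are $\pm\alpha_1,\dots,\pm\alpha_{n-2}$ for some real numbers $\alpha_1,\dots,\alpha_{n-2}>0$.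 3. If $n\ge3$, then $z_0$ is unstable: it is neither spectrally stable, nor linearly stable, nor nonlinearly stable. -/

import Mathlib

open scoped Matrix Kronecker

noncomputable section

namespace PointVortex

/-- Configurations `z = (z₁, …, zₙ) ∈ ℝ²ⁿ` of `n` planar vortices; the coordinates of the `i`-th
vortex are `z (i, 0)` and `z (i, 1)`. -/
abbrev Config (n : ℕ) : Type := EuclideanSpace ℝ (Fin n × Fin 2)

variable {n : ℕ}

/-- The position `zᵢ ∈ ℝ²` of the `i`-th vortex. -/
def pos (z : Config n) (i : Fin n) : EuclideanSpace ℝ (Fin 2) := !₂[z (i, 0), z (i, 1)]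

/-- The vortices are at pairwise distinct positions. -/
def CollisionFree (z : Config n) : Prop := Function.Injective (pos z)

/-- All vortices lie on one line. -/
def IsCollinear (z : Config n) : Prop := Collinear ℝ (Set.range (pos z))

/-- `H(z) = - ∑_{i < j} Γᵢ Γⱼ ln ‖zᵢ - zⱼ‖`. -/
def hamiltonian (Γ : Fin n → ℝ) (z : Config n) : ℝ :=
  -∑ i, ∑ j ∈ Finset.Ioi i, Γ i * Γ j * Real.log ‖pos z i - pos z j‖

/-- The angular impulse `I(z) = ½ ∑ᵢ Γᵢ ‖zᵢ‖²`. -/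
def angularImpulse (Γ : Fin n → ℝ) (z : Config n) : ℝ :=
  (1 / 2) * ∑ i, Γ i * ‖pos z i‖ ^ 2

/-- `M = diag(Γ₁, Γ₁, …, Γₙ, Γₙ)`. -/
def circMatrix (Γ : Fin n → ℝ) : Matrix (Fin n × Fin 2) (Fin n × Fin 2) ℝ :=
  Matrix.diagonal fun a => Γ a.1

/-- The standard `2 × 2` symplectic matrix `J`. -/
def symplJ : Matrix (Fin 2) (Fin 2) ℝ := !![0, 1; -1, 0]

/-- `K`, the block diagonal matrix with `n` diagonal blocks equal to `J`. -/
def symplK (n : ℕ) : Matrix (Fin n × Fin 2) (Fin n × Fin 2) ℝ :=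
  (1 : Matrix (Fin n) (Fin n) ℝ) ⊗ₖ symplJ

/-- `e^{θ J} z = (e^{θ J} z₁, …, e^{θ J} zₙ)`; as `K² = -1`, one has `e^{θ K} = cos θ + (sin θ) K`. -/
def rotate (θ : ℝ) (z : Config n) : Config n :=
  WithLp.toLp 2 (Real.cos θ • z.ofLp + Real.sin θ • (symplK n *ᵥ z.ofLp))

/-- `z` solves the `n`-vortex equations `M ż = K ∇H(z)` at all times in `s`. -/
def IsVortexSolutionOn (Γ : Fin n → ℝ) (z : ℝ → Config n) (s : Set ℝ) : Prop :=
  ∀ t ∈ s, CollisionFree (z t) ∧ ∃ v : Config n, HasDerivAt z v t ∧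
    circMatrix Γ *ᵥ v.ofLp = symplK n *ᵥ (gradient (hamiltonian Γ) (z t)).ofLp

/-- `z` solves the equations in the frame rotating with angular velocity `ω`,
`M ż = K (∇H(z) + ω M z)`, at all times in `s`. -/
def IsRotatingSolutionOn (Γ : Fin n → ℝ) (ω : ℝ) (z : ℝ → Config n) (s : Set ℝ) : Prop :=
  ∀ t ∈ s, CollisionFree (z t) ∧ ∃ v : Config n, HasDerivAt z v t ∧
    circMatrix Γ *ᵥ v.ofLp = symplK n *ᵥ
      ((gradient (hamiltonian Γ) (z t)).ofLp + ω • (circMatrix Γ *ᵥ (z t).ofLp))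

/-- `z₀` is (the initial position of) a relative equilibrium with angular velocity `ω ≠ 0`:
the uniform rotation `zᵢ(t) = e^{-ω J t} zᵢ(0)` solves the `n`-vortex equations. -/
def IsRelativeEquilibrium (Γ : Fin n → ℝ) (ω : ℝ) (z₀ : Config n) : Prop :=
  ω ≠ 0 ∧ IsVortexSolutionOn Γ (fun t => rotate (-ω * t) z₀) Set.univ

/-- The Hessian matrix `D²f(z)`. -/
def hessian (f : Config n → ℝ) (z : Config n) : Matrix (Fin n × Fin 2) (Fin n × Fin 2) ℝ :=
  Matrix.of fun a b =>
    fderiv ℝ (fderiv ℝ f) z (EuclideanSpace.single a 1) (EuclideanSpace.single b 1)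

/-- The stability matrix `B = K (M⁻¹ D²H(z₀) + ω I)`. -/
def stabilityMatrix (Γ : Fin n → ℝ) (ω : ℝ) (z₀ : Config n) :
    Matrix (Fin n × Fin 2) (Fin n × Fin 2) ℝ :=
  symplK n * ((circMatrix Γ)⁻¹ * hessian (hamiltonian Γ) z₀ + ω • 1)

/-- The complex eigenvalues of `B`, with algebraic multiplicity. -/
def eigenvalues (Γ : Fin n → ℝ) (ω : ℝ) (z₀ : Config n) : Multiset ℂ :=
  ((stabilityMatrix Γ ω z₀).map (algebraMap ℝ ℂ)).charpoly.roots

/-- The eigenvalues of `B` that remain after the four trivial ones `0, 0, ω i, -ω i` are removed. -/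
def nontrivialEigenvalues (Γ : Fin n → ℝ) (ω : ℝ) (z₀ : Config n) : Multiset ℂ :=
  eigenvalues Γ ω z₀ - {0, 0, (ω : ℂ) * Complex.I, -((ω : ℂ) * Complex.I)}

/-- All nontrivial eigenvalues are nonzero. -/
def IsNondegenerate (Γ : Fin n → ℝ) (ω : ℝ) (z₀ : Config n) : Prop :=
  (0 : ℂ) ∉ nontrivialEigenvalues Γ ω z₀

/-- Nondegenerate with purely imaginary nontrivial eigenvalues. -/
def IsSpectrallyStable (Γ : Fin n → ℝ) (ω : ℝ) (z₀ : Config n) : Prop :=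
  IsNondegenerate Γ ω z₀ ∧ ∀ l ∈ nontrivialEigenvalues Γ ω z₀, l.re = 0

/-- `V^⊥`, the `M`-orthogonal complement of `V = span {z₀, K z₀}`. -/
def perpV (Γ : Fin n → ℝ) (z₀ : Config n) : Submodule ℝ (Fin n × Fin 2 → ℝ) where
  carrier := {w | ∀ v ∈ Submodule.span ℝ {z₀.ofLp, symplK n *ᵥ z₀.ofLp},
    w ⬝ᵥ (circMatrix Γ *ᵥ v) = 0}
  add_mem' := by
    intro a b ha hb v hv
    rw [add_dotProduct, ha v hv, hb v hv, add_zero]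
  zero_mem' := by
    intro v _
    exact zero_dotProduct _
  smul_mem' := by
    intro c a ha v hv
    rw [smul_dotProduct, ha v hv, smul_zero]

/-- Spectrally stable, and in some basis of the `(2n-2)`-dimensional space `V^⊥` the restriction
of `B` is block diagonal with `2 × 2` blocks `[[0, β], [-β, 0]]`. -/
def IsLinearlyStable (Γ : Fin n → ℝ) (ω : ℝ) (z₀ : Config n) : Prop :=
  IsSpectrallyStable Γ ω z₀ ∧
    ∃ (w : Fin (n - 1) × Fin 2 → Fin n × Fin 2 → ℝ) (β : Fin (n - 1) → ℝ),
      LinearIndependent ℝ w ∧ Submodule.span ℝ (Set.range w) = perpV Γ z₀ ∧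
      ∀ j, stabilityMatrix Γ ω z₀ *ᵥ w (j, 0) = -β j • w (j, 1) ∧
        stabilityMatrix Γ ω z₀ *ᵥ w (j, 1) = β j • w (j, 0)

/-- The closed curve `γ = {e^{J θ} z₀}`. -/
def rotationOrbit (z₀ : Config n) : Set (Config n) := Set.range fun θ : ℝ => rotate θ z₀

/-- Nonlinear (orbital Lyapunov) stability: solutions in the rotating frame which start close to `z₀`
stay close to `γ`, forwards and backwards, as long as they exist. (Being confined to a compact
collision-free set, they then exist for all times.) -/
def IsNonlinearlyStable (Γ : Fin n → ℝ) (ω : ℝ) (z₀ : Config n) : Prop :=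
  ∀ ε > 0, ∃ δ > 0, ∀ (ζ : ℝ → Config n) (a b : ℝ), a < 0 → 0 < b →
    IsRotatingSolutionOn Γ ω ζ (Set.Ioo a b) → ‖ζ 0 - z₀‖ < δ →
    ∀ t ∈ Set.Ioo a b, Metric.infDist (ζ t) (rotationOrbit z₀) < ε

/-- The Lagrangian function `G = H + ω I`. -/
def lagrangian (Γ : Fin n → ℝ) (ω : ℝ) (z : Config n) : ℝ :=
  hamiltonian Γ z + ω * angularImpulse Γ z

/-- The tangent space at `z₀` of the level surface `S` of `I` through `z₀`, that is, the
`M`-orthogonal complement of `z₀`. -/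
def tangentSpace (Γ : Fin n → ℝ) (z₀ : Config n) : Submodule ℝ (Fin n × Fin 2 → ℝ) where
  carrier := {v | v ⬝ᵥ (circMatrix Γ *ᵥ z₀.ofLp) = 0}
  add_mem' := by
    intro a b ha hb
    exact (add_dotProduct _ _ _).trans (by rw [show a ⬝ᵥ _ = 0 from ha, show b ⬝ᵥ _ = 0 from hb, add_zero])
  zero_mem' := zero_dotProduct _
  smul_mem' := by
    intro c a ha
    exact (smul_dotProduct _ _ _).trans (by rw [show a ⬝ᵥ _ = 0 from ha, smul_zero])

/-- The Morse index of `z₀` as a critical point of `H` on `S`: the largest dimension of a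
subspace of the tangent space on which `q(v) = vᵀ D²G(z₀) v` is negative definite. -/
def morseIndex (Γ : Fin n → ℝ) (ω : ℝ) (z₀ : Config n) : ℕ :=
  sSup {k | ∃ W : Submodule ℝ (Fin n × Fin 2 → ℝ), W ≤ tangentSpace Γ z₀ ∧
    (∀ v ∈ W, v ≠ 0 → v ⬝ᵥ (hessian (lagrangian Γ ω) z₀ *ᵥ v) < 0) ∧ Module.finrank ℝ W = k}

end PointVortex

end

/-!
A collinear relative equilibrium with positive circulations lies on a line through the centre of
vorticity, with coordinates `xᵢ` that solve `ω xᵢ = ∑ⱼ Γⱼ / (xᵢ - xⱼ)`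
(`IsRelativeEquilibrium.exists_line`). Split a displacement into its parts `a` along and `b` across
the line. The Hessian of `ln ‖w‖` is `∓ 1 / ‖w‖²` along and across `w`, so the Hessian of `H` is
`M A` on `a` and `-M A` on `b`, where `(A a)ᵢ = ∑ⱼ Γⱼ (aᵢ - aⱼ) / (xᵢ - xⱼ)²` is symmetric for the
inner product with weights `Γ` (`hessian_hamiltonian_of_line`).

Everything follows from the spectrum of `A`: the eigenvalues `0` (constants) and `ω` (multiples of
`x`) are simple and all others exceed `ω`. For the last claim, let the slope
`(aᵢ - aⱼ) / (xᵢ - xⱼ)` of an eigenvector `a` with eigenvalue `μ` be maximal, equal to `p > 0`, for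
the pair `(i, k)`. Comparing `(A a)ᵢ - (A a)ₖ` with `p` times the equilibrium equations leaves a sum
of nonnegative terms, so `μ ≥ ω`, and equality forces all slopes to be equal to `p`
(`IsCollinearEquilibrium.slope_le`, `IsCollinearEquilibrium.eigenvalue_trichotomy`).

In an eigenbasis of `A` with eigenvalues `μₖ`, the Hessian of `H + ω I` is diagonal with entries
`μₖ + ω` and `ω - μₖ`, and the linearised equations decouple into
`y₀' = (ω - μₖ) y₁`, `y₁' = -(μₖ + ω) y₀` (`IsNormalForm`). The `n - 2` modes with `μₖ > ω` give one
negative direction each, hence the Morse index, and the eigenvalues `± √(μₖ² - ω²)`.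

For nonlinear instability let `α` be the largest of these eigenvalues and `ℓ` a left eigenvector for
it. In suitable weighted normal coordinates the linear flow expands no faster than `e^{α t}`, without
loss in the exponent, because the only Jordan block belongs to the eigenvalue `0 < α`. Hence a
solution that starts at `z₀ + d e` with `ℓ e = 1` stays of the order of `d e^{α t}`, and the
quadratic remainder cannot prevent `ℓ` from growing to a size independent of `d`
(`exists_escaping_solution`). Since `ℓ` vanishes on the span of `z₀` and `K z₀`, which contains the
circle of rotated configurations, the solution leaves a neighbourhood of that circle.
-/

noncomputable section

namespace PointVortex

variable {n : ℕ}

/-! ### Derivatives of the Hamiltonian and of the angular impulse -/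

/-- The squared mutual distance `‖zᵢ - zⱼ‖²`, in coordinates. -/
def sqDist (i j : Fin n) (z : Config n) : ℝ :=
  (z (i, 0) - z (j, 0)) ^ 2 + (z (i, 1) - z (j, 1)) ^ 2

lemma sqDist_self (i : Fin n) (z : Config n) : sqDist i i z = 0 := by simp [sqDist]

lemma sqDist_comm (i j : Fin n) (z : Config n) : sqDist i j z = sqDist j i z := by
  simp only [sqDist]; ring

lemma sqDist_eq_norm_sq (i j : Fin n) (z : Config n) :
    sqDist i j z = ‖pos z i - pos z j‖ ^ 2 := by
  simp [sqDist, EuclideanSpace.norm_sq_eq, pos, Fin.sum_univ_two]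

lemma log_norm_pos_sub (i j : Fin n) (z : Config n) :
    Real.log ‖pos z i - pos z j‖ = (1 / 2) * Real.log (sqDist i j z) := by
  rw [sqDist_eq_norm_sq, Real.log_pow]; push_cast; ring

lemma CollisionFree.sqDist_pos {z : Config n} (hz : CollisionFree z) {i j : Fin n} (hij : i ≠ j) :
    0 < sqDist i j z := by
  rw [sqDist_eq_norm_sq]
  have : pos z i - pos z j ≠ 0 := sub_ne_zero.2 fun h => hij (hz h)
  positivity

/-- The sum over unordered pairs written as half of a sum over ordered pairs; the diagonal terms
vanish because `Real.log 0 = 0`. -/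
lemma hamiltonian_eq_sum (Γ : Fin n → ℝ) (z : Config n) :
    hamiltonian Γ z = -(1 / 4) * ∑ i, ∑ j, Γ i * Γ j * Real.log (sqDist i j z) := by
  have h := Finset.sum_sum_Ioi_add_eq_sum_sum_off_diag
    (fun i j : Fin n => Γ i * Γ j * Real.log (sqDist i j z))
  have h2 : ∀ i : Fin n, ∑ j ∈ ({i} : Finset (Fin n))ᶜ, Γ j * Γ i * Real.log (sqDist j i z)
      = ∑ j, Γ i * Γ j * Real.log (sqDist i j z) := by
    intro i
    rw [← Finset.sum_compl_add_sum {i} fun j => Γ i * Γ j * Real.log (sqDist i j z)]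
    simp only [Finset.sum_singleton, sqDist_self, Real.log_zero, mul_zero, add_zero]
    exact Finset.sum_congr rfl fun j _ => by rw [sqDist_comm, mul_comm (Γ j)]
  rw [Finset.sum_congr rfl fun i _ => h2 i] at h
  rw [← h, hamiltonian, Finset.mul_sum, ← Finset.sum_neg_distrib]
  refine Finset.sum_congr rfl fun i _ => ?_
  rw [Finset.mul_sum, ← Finset.sum_neg_distrib]
  refine Finset.sum_congr rfl fun j _ => ?_
  rw [log_norm_pos_sub, sqDist_comm j i]; ring

/-- The explicit gradient of the Hamiltonian,
`-∑ⱼ Γᵢ Γⱼ (zᵢ - zⱼ) / ‖zᵢ - zⱼ‖²` in the `i`-th slot; the term `j = i` is `0 / 0 = 0`. -/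
def hamGrad (Γ : Fin n → ℝ) (z : Config n) (a : Fin n × Fin 2) : ℝ :=
  -∑ j, Γ a.1 * Γ j * ((z a - z (j, a.2)) / sqDist a.1 j z)

/-- The coordinate functional `z ↦ z a`. -/
abbrev coord (a : Fin n × Fin 2) : Config n →L[ℝ] ℝ := EuclideanSpace.proj a

lemma hasFDerivAt_coord (a : Fin n × Fin 2) (z : Config n) :
    HasFDerivAt (fun z : Config n => z a) (coord a) z :=
  (coord a).hasFDerivAt

lemma hasFDerivAt_sqDist (i j : Fin n) (z : Config n) :
    HasFDerivAt (sqDist i j)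
      ((2 * (z (i, 0) - z (j, 0))) • (coord (i, 0) - coord (j, 0)) +
        (2 * (z (i, 1) - z (j, 1))) • (coord (i, 1) - coord (j, 1))) z := by
  have h := fun s : Fin 2 =>
    ((hasFDerivAt_coord (i, s) z).fun_sub (hasFDerivAt_coord (j, s) z)).pow 2
  refine ((h 0).fun_add (h 1)).congr_fderiv ?_
  simp

lemma contDiff_sqDist (i j : Fin n) {k : WithTop ℕ∞} : ContDiff ℝ k (sqDist (n := n) i j) := by
  have h : ∀ a : Fin n × Fin 2, ContDiff ℝ k fun z : Config n => z a := fun a => (coord a).contDiff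
  exact (((h _).sub (h _)).pow 2).add (((h _).sub (h _)).pow 2)

lemma contDiffAt_hamiltonian (Γ : Fin n → ℝ) {z : Config n} (hz : CollisionFree z)
    {k : WithTop ℕ∞} : ContDiffAt ℝ k (hamiltonian Γ) z := by
  rw [show hamiltonian Γ = _ from funext (hamiltonian_eq_sum Γ)]
  refine contDiffAt_const.mul (ContDiffAt.sum fun i _ => ContDiffAt.sum fun j _ => ?_)
  by_cases hij : i = j
  · subst hij
    simp only [sqDist_self]
    exact contDiffAt_const
  · exact contDiffAt_const.mul ((contDiff_sqDist i j).contDiffAt.log (hz.sqDist_pos hij).ne')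

lemma contDiffAt_hamGrad (Γ : Fin n → ℝ) {z : Config n} (hz : CollisionFree z)
    (a : Fin n × Fin 2) {k : WithTop ℕ∞} : ContDiffAt ℝ k (fun z => hamGrad Γ z a) z := by
  have h : ∀ a : Fin n × Fin 2, ContDiffAt ℝ k (fun z : Config n => z a) z :=
    fun a => (coord a).contDiff.contDiffAt
  refine ContDiffAt.neg (ContDiffAt.sum fun j _ => ?_)
  by_cases hij : a.1 = j
  · subst hij
    simp only [sqDist_self, div_zero, mul_zero]
    exact contDiffAt_const
  · exact contDiffAt_const.mul
      (((h _).sub (h _)).div (contDiff_sqDist _ j).contDiffAt (hz.sqDist_pos hij).ne')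

lemma fderiv_hamiltonian_single (Γ : Fin n → ℝ) {z : Config n} (hz : CollisionFree z)
    (a : Fin n × Fin 2) :
    fderiv ℝ (hamiltonian Γ) z (EuclideanSpace.single a 1) = hamGrad Γ z a := by
  have hterm : ∀ i j : Fin n, HasFDerivAt (fun z => Γ i * Γ j * Real.log (sqDist i j z))
      ((Γ i * Γ j) • (sqDist i j z)⁻¹ •
      ((2 * (z (i, 0) - z (j, 0))) • (coord (i, 0) - coord (j, 0)) +
        (2 * (z (i, 1) - z (j, 1))) • (coord (i, 1) - coord (j, 1)))) z := by
    intro i j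
    by_cases hij : i = j
    · subst hij
      simp only [sqDist_self, Real.log_zero, mul_zero, sub_self, smul_zero, add_zero]
      exact hasFDerivAt_const (0 : ℝ) z
    · exact ((hasFDerivAt_sqDist i j z).log (hz.sqDist_pos hij).ne').const_mul _
  have hH := (HasFDerivAt.fun_sum (u := Finset.univ) fun i _ =>
    HasFDerivAt.fun_sum (u := Finset.univ) fun j _ => hterm i j).const_mul (-(1 / 4))
  rw [show hamiltonian Γ = _ from funext (hamiltonian_eq_sum Γ), hH.fderiv]
  obtain ⟨p, t⟩ := a
  have key : ∀ i j : Fin n, ((Γ i * Γ j) • (sqDist i j z)⁻¹ •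
      ((2 * (z (i, 0) - z (j, 0))) • (coord (i, 0) - coord (j, 0)) +
        (2 * (z (i, 1) - z (j, 1))) • (coord (i, 1) - coord (j, 1))))
        (EuclideanSpace.single (p, t) 1) =
      (if i = p then 2 * (Γ p * Γ j * ((z (p, t) - z (j, t)) / sqDist p j z)) else 0) +
      (if j = p then 2 * (Γ p * Γ i * ((z (p, t) - z (i, t)) / sqDist p i z)) else 0) := by
    intro i j
    fin_cases t <;> by_cases h1 : i = p <;> by_cases h2 : j = p <;>
      simp [h1, h2, sqDist_self] <;>
      first | ring1 | (rw [sqDist_comm i p]; ring1)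
  simp only [smul_apply, sum_apply] at key ⊢
  simp only [key, Finset.sum_add_distrib]
  rw [Finset.sum_comm]
  simp only [Finset.sum_ite_eq', Finset.mem_univ, if_true]
  rw [hamGrad, ← Finset.mul_sum, smul_eq_mul]
  dsimp only
  ring

lemma gradient_apply (f : Config n → ℝ) (z : Config n) (a : Fin n × Fin 2) :
    gradient f z a = fderiv ℝ f z (EuclideanSpace.single a 1) := by
  have h := InnerProductSpace.toDual_symm_apply (𝕜 := ℝ) (x := EuclideanSpace.single a (1 : ℝ))
    (y := fderiv ℝ f z)
  rw [← h, gradient, EuclideanSpace.inner_single_right]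
  simp

lemma gradient_hamiltonian (Γ : Fin n → ℝ) {z : Config n} (hz : CollisionFree z) :
    (gradient (hamiltonian Γ) z).ofLp = hamGrad Γ z := by
  funext a
  exact (gradient_apply _ _ _).trans (fderiv_hamiltonian_single Γ hz a)

lemma angularImpulse_eq (Γ : Fin n → ℝ) (z : Config n) :
    angularImpulse Γ z = (1 / 2) * ∑ a : Fin n × Fin 2, Γ a.1 * z a ^ 2 := by
  simp [angularImpulse, Fintype.sum_prod_type, EuclideanSpace.norm_sq_eq, pos, Fin.sum_univ_two,
    mul_add]

lemma hasFDerivAt_angularImpulse (Γ : Fin n → ℝ) (z : Config n) :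
    HasFDerivAt (angularImpulse Γ) (∑ a : Fin n × Fin 2, (Γ a.1 * z a) • coord a) z := by
  rw [show angularImpulse Γ = _ from funext (angularImpulse_eq Γ)]
  have := (HasFDerivAt.fun_sum (u := Finset.univ) fun (a : Fin n × Fin 2) _ =>
    ((hasFDerivAt_coord a z).pow 2).const_mul (Γ a.1)).const_mul (1 / 2)
  refine this.congr_fderiv ?_
  rw [Finset.smul_sum]
  refine Finset.sum_congr rfl fun a _ => ?_
  rw [smul_smul, smul_smul]
  congr 1
  simp
  ring

lemma fderiv_angularImpulse_single (Γ : Fin n → ℝ) (z : Config n) (a : Fin n × Fin 2) :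
    fderiv ℝ (angularImpulse Γ) z (EuclideanSpace.single a 1) = Γ a.1 * z a := by
  rw [(hasFDerivAt_angularImpulse Γ z).fderiv]
  simp

lemma isOpen_setOf_collisionFree : IsOpen {z : Config n | CollisionFree z} := by
  have : {z : Config n | CollisionFree z} =
      ⋂ i : Fin n, ⋂ j : Fin n, {z | i = j ∨ 0 < sqDist i j z} := by
    ext z
    simp only [Set.mem_ofPred_eq, Set.mem_iInter]
    constructor
    · intro h i j
      by_cases hij : i = j
      · exact Or.inl hij
      · exact Or.inr (h.sqDist_pos hij)
    · intro h i j hij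
      rcases h i j with h | h
      · exact h
      · rw [sqDist_eq_norm_sq, hij] at h
        simp at h
  rw [this]
  refine isOpen_iInter_of_finite fun i => isOpen_iInter_of_finite fun j => ?_
  by_cases hij : i = j
  · simp [hij]
  · simp only [hij, false_or]
    exact isOpen_lt continuous_const (contDiff_sqDist i j (k := 0)).continuous

lemma CollisionFree.eventually {z : Config n} (hz : CollisionFree z) :
    ∀ᶠ z' in nhds z, CollisionFree z' :=
  isOpen_setOf_collisionFree.mem_nhds hz

/-- A second derivative is a directional derivative of a component of the gradient. -/
lemma hessian_apply_of_eventuallyEq {f : Config n → ℝ} {z : Config n} (hf : ContDiffAt ℝ 2 f z)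
    {g : Config n → ℝ} {b : Fin n × Fin 2}
    (hg : ∀ᶠ z' in nhds z, fderiv ℝ f z' (EuclideanSpace.single b 1) = g z') (a : Fin n × Fin 2) :
    hessian f z a b = fderiv ℝ g z (EuclideanSpace.single a 1) := by
  have hd : DifferentiableAt ℝ (fderiv ℝ f) z :=
    (hf.fderiv_right (m := 1) (by norm_num)).differentiableAt (by norm_num)
  rw [← Filter.EventuallyEq.fderiv_eq hg, hessian, Matrix.of_apply]
  rw [fderiv_clm_apply hd (differentiableAt_const _)]
  simp

lemma hessian_hamiltonian_apply (Γ : Fin n → ℝ) {z : Config n} (hz : CollisionFree z)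
    (a b : Fin n × Fin 2) :
    hessian (hamiltonian Γ) z a b =
      fderiv ℝ (fun z => hamGrad Γ z b) z (EuclideanSpace.single a 1) :=
  hessian_apply_of_eventuallyEq (contDiffAt_hamiltonian Γ hz)
    (hz.eventually.mono fun _ h => fderiv_hamiltonian_single Γ h b) a

lemma hessian_lagrangian (Γ : Fin n → ℝ) (ω : ℝ) {z : Config n} (hz : CollisionFree z) :
    hessian (lagrangian Γ ω) z = hessian (hamiltonian Γ) z + ω • circMatrix Γ := by
  ext a b
  have hI : ContDiff ℝ 2 (angularImpulse (n := n) Γ) := by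
    rw [show angularImpulse Γ = _ from funext (angularImpulse_eq Γ)]
    exact contDiff_const.mul (ContDiff.sum fun a _ => contDiff_const.mul ((coord a).contDiff.pow 2))
  have hL : ContDiffAt ℝ 2 (lagrangian Γ ω) z :=
    (contDiffAt_hamiltonian Γ hz).add (contDiffAt_const.mul hI.contDiffAt)
  rw [hessian_apply_of_eventuallyEq hL (g := fun z => hamGrad Γ z b + ω * (Γ b.1 * z b)) (b := b),
    Matrix.add_apply, Matrix.smul_apply, hessian_hamiltonian_apply Γ hz]
  · have h1 := (contDiffAt_hamGrad Γ hz b (k := 1)).differentiableAt (by norm_num)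
    have h2 := ((hasFDerivAt_coord b z).const_mul (Γ b.1)).const_mul ω
    rw [(h1.hasFDerivAt.fun_add h2).fderiv]
    by_cases hab : a = b
    · simp [circMatrix, hab]
    · simp [circMatrix, hab, Ne.symm hab]
  · refine hz.eventually.mono fun z' h => ?_
    have h1 := (contDiffAt_hamiltonian Γ h (k := 1)).differentiableAt (by norm_num)
    have h2 := ((hI.differentiable (by norm_num)).differentiableAt (x := z')).const_mul ω
    change fderiv ℝ (fun z => hamiltonian Γ z + ω * angularImpulse Γ z) z' _ = _
    rw [fderiv_fun_add h1 h2, fderiv_const_mul (hI.differentiable (by norm_num)).differentiableAt,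
      add_apply, fderiv_hamiltonian_single Γ h, smul_apply,
      fderiv_angularImpulse_single, smul_eq_mul]

/-! ### The weighted Laplacian of the inverse squared distances -/

/-- `x` solves the collinear central configuration equations `ω xᵢ = ∑_{j ≠ i} Γⱼ / (xᵢ - xⱼ)`;
the term `j = i` of the sum is `Γᵢ / 0 = 0`. -/
def IsCollinearEquilibrium (Γ : Fin n → ℝ) (ω : ℝ) (x : Fin n → ℝ) : Prop :=
  Function.Injective x ∧ ∀ i, ω * x i = ∑ j, Γ j / (x i - x j)

/-- The operator `(A a)ᵢ = ∑_{j ≠ i} Γⱼ (aᵢ - aⱼ) / (xᵢ - xⱼ)²`, which is symmetric for the inner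
product with weights `Γ`. -/
def distLaplacian (Γ x a : Fin n → ℝ) (i : Fin n) : ℝ :=
  ∑ j, Γ j * (a i - a j) / (x i - x j) ^ 2

lemma IsCollinearEquilibrium.distLaplacian_self {Γ x : Fin n → ℝ} {ω : ℝ}
    (h : IsCollinearEquilibrium Γ ω x) (i : Fin n) : distLaplacian Γ x x i = ω * x i := by
  rw [h.2, distLaplacian]
  refine Finset.sum_congr rfl fun j _ => ?_
  by_cases hij : x i - x j = 0
  · simp [hij]
  · field_simp

lemma distLaplacian_const (Γ x : Fin n → ℝ) (c : ℝ) (i : Fin n) :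
    distLaplacian Γ x (fun _ => c) i = 0 := by simp [distLaplacian]

/-- Let the pair `(i, k)` realise the maximal slope `p` of `a` as a function of `x`. Subtracting
`p` times the equilibrium equations from the differences of `A a` leaves a sum of nonnegative
terms. -/
lemma IsCollinearEquilibrium.slope_le {Γ x : Fin n → ℝ} {ω : ℝ}
    (h : IsCollinearEquilibrium Γ ω x) (hΓ : ∀ i, 0 < Γ i) {a : Fin n → ℝ} {p : ℝ} {i k : Fin n}
    (hik : x k < x i) (hp : a i - a k = p * (x i - x k))
    (hmax : ∀ j l, x l < x j → a j - a l ≤ p * (x j - x l)) :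
    p * ω * (x i - x k) ≤ distLaplacian Γ x a i - distLaplacian Γ x a k ∧
      (p * ω * (x i - x k) = distLaplacian Γ x a i - distLaplacian Γ x a k →
        ∀ j, a j - a k = p * (x j - x k)) := by
  -- `e j = aᵢ - aⱼ - p (xᵢ - xⱼ)`, which is unchanged when `i` is replaced by `k`
  set e : Fin n → ℝ := fun j => a i - a j - p * (x i - x j) with he
  have hek : ∀ j, a k - a j - p * (x k - x j) = e j := fun j => by simp only [he]; linarith
  have hid : distLaplacian Γ x a i - distLaplacian Γ x a k - p * ω * (x i - x k) =
      ∑ j, Γ j * (e j / (x i - x j) ^ 2 - e j / (x k - x j) ^ 2) := by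
    have h1 : ∀ m, (∀ j, a m - a j - p * (x m - x j) = e j) →
        distLaplacian Γ x a m - p * (ω * x m) = ∑ j, Γ j * (e j / (x m - x j) ^ 2) := by
      intro m hm
      rw [h.2, distLaplacian, Finset.mul_sum, ← Finset.sum_sub_distrib]
      refine Finset.sum_congr rfl fun j _ => ?_
      by_cases hmj : x m - x j = 0
      · simp [hmj]
      · rw [← hm j]; field_simp
    have h2 := h1 i fun j => rfl
    have h3 := h1 k hek
    simp only [mul_sub, Finset.sum_sub_distrib] at h2 h3 ⊢
    linarith
  have hnn : ∀ j, 0 ≤ Γ j * (e j / (x i - x j) ^ 2 - e j / (x k - x j) ^ 2) ∧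
      (Γ j * (e j / (x i - x j) ^ 2 - e j / (x k - x j) ^ 2) = 0 → e j = 0) := by
    intro j
    rcases lt_trichotomy (x j) (x k) with hj | hj | hj
    · have h1 : e j ≤ 0 := by
        have := hmax k j hj; rw [← hek j]; linarith
      have h2 : 1 / (x i - x j) ^ 2 < 1 / (x k - x j) ^ 2 := by
        apply one_div_lt_one_div_of_lt
        · have : 0 < x k - x j := by linarith
          positivity
        · apply pow_lt_pow_left₀ <;> linarith
      rw [show Γ j * (e j / (x i - x j) ^ 2 - e j / (x k - x j) ^ 2) =
        Γ j * (-e j) * (1 / (x k - x j) ^ 2 - 1 / (x i - x j) ^ 2) by ring]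
      refine ⟨mul_nonneg (mul_nonneg (hΓ j).le (by linarith)) (by linarith), fun h0 => ?_⟩
      rcases mul_eq_zero.1 h0 with h0 | h0
      · rcases mul_eq_zero.1 h0 with h0 | h0
        · exact absurd h0 (hΓ j).ne'
        · linarith
      · linarith
    · obtain rfl := h.1 hj
      have : e j = 0 := by rw [← hek j]; ring
      simp [this]
    · rcases lt_trichotomy (x j) (x i) with hj' | hj' | hj'
      · have h1 : e j ≤ 0 := by
          have := hmax i j hj'; simp only [he]; linarith
        have h2 : 0 ≤ e j := by
          have := hmax j k hj; rw [← hek j]; linarith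
        have : e j = 0 := le_antisymm h1 h2
        simp [this]
      · obtain rfl := h.1 hj'
        have : e j = 0 := by simp only [he]; ring
        simp [this]
      · have h1 : 0 ≤ e j := by
          have := hmax j i hj'; simp only [he]; linarith
        have h2 : 1 / (x k - x j) ^ 2 < 1 / (x i - x j) ^ 2 := by
          rw [← neg_sub (x j) (x k), ← neg_sub (x j) (x i), neg_sq, neg_sq]
          apply one_div_lt_one_div_of_lt
          · have : 0 < x j - x i := by linarith
            positivity
          · apply pow_lt_pow_left₀ <;> linarith
        rw [show Γ j * (e j / (x i - x j) ^ 2 - e j / (x k - x j) ^ 2) =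
          Γ j * e j * (1 / (x i - x j) ^ 2 - 1 / (x k - x j) ^ 2) by ring]
        refine ⟨mul_nonneg (mul_nonneg (hΓ j).le (by linarith)) (by linarith), fun h0 => ?_⟩
        rcases mul_eq_zero.1 h0 with h0 | h0
        · rcases mul_eq_zero.1 h0 with h0 | h0
          · exact absurd h0 (hΓ j).ne'
          · linarith
        · linarith
  refine ⟨?_, fun heq j => ?_⟩
  · have := Finset.sum_nonneg fun j (_ : j ∈ Finset.univ) => (hnn j).1
    linarith
  · have hs : ∑ j, Γ j * (e j / (x i - x j) ^ 2 - e j / (x k - x j) ^ 2) = 0 := by linarith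
    have := (hnn j).2 ((Finset.sum_eq_zero_iff_of_nonneg fun j _ => (hnn j).1).1 hs j
      (Finset.mem_univ j))
    rw [← hek j] at this
    linarith

/-- The eigenvalue `0` of the Laplacian belongs to the constants, `ω` to the multiples of `x`, and
all other eigenvalues exceed `ω`. -/
lemma IsCollinearEquilibrium.eigenvalue_trichotomy {Γ x : Fin n → ℝ} {ω : ℝ}
    (h : IsCollinearEquilibrium Γ ω x) (hΓ : ∀ i, 0 < Γ i) (hω : 0 < ω) {a : Fin n → ℝ} {μ : ℝ}
    (ha : a ≠ 0) (hμ : ∀ i, distLaplacian Γ x a i = μ * a i) :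
    (μ = 0 ∧ ∃ c, ∀ i, a i = c) ∨ (μ = ω ∧ ∃ c, ∀ i, a i = c * x i) ∨ ω < μ := by
  by_cases hc : ∃ c, ∀ i, a i = c
  · left
    refine ⟨?_, hc⟩
    obtain ⟨c, hc⟩ := hc
    obtain ⟨i, hi⟩ := Function.ne_iff.1 ha
    have h1 := hμ i
    rw [show a = fun _ => c from funext hc, distLaplacian_const] at h1
    rw [hc, Pi.zero_apply] at hi
    exact (mul_eq_zero.1 h1.symm).resolve_right hi
  right
  -- up to the sign of `a`, some slope is positive
  suffices H : ∀ b : Fin n → ℝ, (∀ i, distLaplacian Γ x b i = μ * b i) →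
      (∃ i k, x k < x i ∧ b k < b i) → (μ = ω ∧ ∃ c, ∀ i, b i = c * x i) ∨ ω < μ by
    push Not at hc
    have hne : Nonempty (Fin n) := ⟨(Function.ne_iff.1 ha).choose⟩
    obtain ⟨k⟩ := hne
    obtain ⟨i, hi⟩ := hc (a k)
    have hxik : x i ≠ x k := fun hx => hi (by rw [h.1 hx])
    have hneg : ∀ i, distLaplacian Γ x (-a) i = μ * (-a) i := by
      intro i
      have := hμ i
      rw [distLaplacian] at this ⊢
      rw [Pi.neg_apply, mul_neg, ← this, ← Finset.sum_neg_distrib]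
      exact Finset.sum_congr rfl fun j _ => by simp only [Pi.neg_apply]; ring
    by_cases hs : ∃ i k, x k < x i ∧ a k < a i
    · exact H a hμ hs
    · have hs' : ∃ i k, x k < x i ∧ (-a) k < (-a) i := by
        push Not at hs
        rcases lt_or_gt_of_ne hxik with hx | hx
        · exact ⟨k, i, hx, by
            simpa using lt_of_le_of_ne (hs k i hx) (fun h => hi h.symm)⟩
        · exact ⟨i, k, hx, by simpa using lt_of_le_of_ne (hs i k hx) hi⟩
      refine (H (-a) hneg hs').imp_left fun ⟨h1, c, h2⟩ => ⟨h1, -c, fun i => ?_⟩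
      have := h2 i
      rw [Pi.neg_apply] at this
      linarith
  rintro b hb ⟨i₀, k₀, hx₀, hb₀⟩
  obtain ⟨⟨i, k⟩, hmem, hmaxs⟩ := Finset.exists_max_image
    (Finset.univ.filter fun q : Fin n × Fin n => x q.2 < x q.1)
    (fun q => (b q.1 - b q.2) / (x q.1 - x q.2)) ⟨(i₀, k₀), by simpa using hx₀⟩
  have hik : x k < x i := by simpa using hmem
  have hikpos : 0 < x i - x k := sub_pos.2 hik
  set p := (b i - b k) / (x i - x k) with hpdef
  have hmax : ∀ j l, x l < x j → b j - b l ≤ p * (x j - x l) := fun j l hjl =>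
    (div_le_iff₀ (sub_pos.2 hjl)).1 (hmaxs (j, l) (by simpa using hjl))
  have hp : b i - b k = p * (x i - x k) := by rw [hpdef]; field_simp
  have hppos : 0 < p := by
    refine lt_of_lt_of_le (div_pos (sub_pos.2 hb₀) (sub_pos.2 hx₀)) (hmaxs (i₀, k₀) ?_)
    simpa using hx₀
  obtain ⟨hle, heq⟩ := h.slope_le hΓ hik hp hmax
  rw [hb, hb, ← mul_sub, hp] at hle heq
  have hd : 0 < p * (x i - x k) := mul_pos hppos hikpos
  have hωμ : ω ≤ μ := le_of_mul_le_mul_right (by linarith) hd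
  rcases hωμ.eq_or_lt with hωμ | hωμ
  · left
    refine ⟨hωμ.symm, p, fun j => ?_⟩
    have haff := heq (by rw [hωμ]; ring)
    -- `b = p x + const`, and the constant is annihilated by `A` but multiplied by `ω`
    have hbj := hb j
    have : distLaplacian Γ x b j = p * distLaplacian Γ x x j := by
      simp only [distLaplacian, Finset.mul_sum]
      refine Finset.sum_congr rfl fun l _ => ?_
      rw [show b j - b l = p * (x j - x l) by have := haff j; have := haff l; linarith]
      ring
    rw [this, h.distLaplacian_self, ← hωμ] at hbj
    have : ω * (p * x j) = ω * b j := by linarith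
    exact (mul_left_cancel₀ hω.ne' this).symm
  · exact Or.inr hωμ

/-- Multiplying the equilibrium equations by `Γᵢ xᵢ` and summing gives
`ω ∑ᵢ Γᵢ xᵢ² = ∑_{i < j} Γᵢ Γⱼ`. -/
lemma IsCollinearEquilibrium.omega_pos {Γ x : Fin n → ℝ} {ω : ℝ}
    (h : IsCollinearEquilibrium Γ ω x) (hΓ : ∀ i, 0 < Γ i) (hn : 2 ≤ n) : 0 < ω := by
  have h1 : ω * (2 * ∑ i, Γ i * x i ^ 2) = ∑ i, ∑ j, if i = j then 0 else Γ i * Γ j := by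
    have h2 : ω * ∑ i, Γ i * x i ^ 2 = ∑ i, ∑ j, Γ i * x i * (Γ j / (x i - x j)) := by
      rw [Finset.mul_sum]
      refine Finset.sum_congr rfl fun i _ => ?_
      rw [← Finset.mul_sum, ← h.2]; ring
    have h3 : ω * (2 * ∑ i, Γ i * x i ^ 2) = (∑ i, ∑ j, Γ i * x i * (Γ j / (x i - x j))) +
        ∑ i, ∑ j, Γ j * x j * (Γ i / (x j - x i)) := by
      rw [Finset.sum_comm (f := fun i j => Γ j * x j * (Γ i / (x j - x i))), ← h2]; ring
    rw [h3, ← Finset.sum_add_distrib]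
    refine Finset.sum_congr rfl fun i _ => ?_
    rw [← Finset.sum_add_distrib]
    refine Finset.sum_congr rfl fun j _ => ?_
    by_cases hij : i = j
    · simp [hij]
    · have hx : x i - x j ≠ 0 := sub_ne_zero.2 fun hx => hij (h.1 hx)
      rw [if_neg hij, ← neg_sub (x i) (x j)]
      field_simp
      ring
  have h2 : 0 < ∑ i, ∑ j, if i = j then 0 else Γ i * Γ j := by
    have hnn : ∀ i j : Fin n, 0 ≤ if i = j then 0 else Γ i * Γ j := by
      intro i j
      split_ifs
      · exact le_rfl
      · exact (mul_pos (hΓ i) (hΓ j)).le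
    refine Finset.sum_pos' (fun i _ => Finset.sum_nonneg fun j _ => hnn i j)
      ⟨⟨0, by omega⟩, Finset.mem_univ _, Finset.sum_pos' (fun j _ => hnn _ j)
        ⟨⟨1, by omega⟩, Finset.mem_univ _, ?_⟩⟩
    simp [hΓ]
  rw [← h1] at h2
  have h3 : 0 ≤ 2 * ∑ i, Γ i * x i ^ 2 := by
    have := Finset.sum_nonneg fun i (_ : i ∈ Finset.univ) => mul_nonneg (hΓ i).le (sq_nonneg (x i))
    linarith
  exact pos_of_mul_pos_left h2 h3

/-- The matrix `M A` of the quadratic form `½ ∑_{i, j} Γᵢ Γⱼ (aᵢ - aⱼ)² / (xᵢ - xⱼ)²`. -/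
def distLaplacianMatrix (Γ x : Fin n → ℝ) : Matrix (Fin n) (Fin n) ℝ :=
  Matrix.of fun p q => (if p = q then ∑ j, Γ p * Γ j / (x p - x j) ^ 2 else 0) -
    Γ p * Γ q / (x p - x q) ^ 2

lemma distLaplacianMatrix_comm (Γ x : Fin n → ℝ) (p q : Fin n) :
    distLaplacianMatrix Γ x p q = distLaplacianMatrix Γ x q p := by
  by_cases hpq : p = q
  · rw [hpq]
  · simp only [distLaplacianMatrix, Matrix.of_apply, hpq, Ne.symm hpq, if_false]
    rw [← neg_sub (x q) (x p)]; ring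

lemma distLaplacianMatrix_mulVec (Γ x a : Fin n → ℝ) (p : Fin n) :
    (distLaplacianMatrix Γ x *ᵥ a) p = Γ p * distLaplacian Γ x a p := by
  simp only [Matrix.mulVec, dotProduct, distLaplacianMatrix, Matrix.of_apply, sub_mul,
    Finset.sum_sub_distrib, ite_mul, zero_mul, Finset.sum_ite_eq, Finset.mem_univ, if_true,
    distLaplacian, Finset.mul_sum, Finset.sum_mul]
  rw [← Finset.sum_sub_distrib]
  exact Finset.sum_congr rfl fun j _ => by ring

/-- A weighted orthonormal basis of eigenvectors, from the spectral theorem applied to the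
symmetric matrix `M^{-1/2} (M A) M^{-1/2}`. -/
lemma exists_eigenbasis (Γ x : Fin n → ℝ) (hΓ : ∀ i, 0 < Γ i) :
    ∃ (V : Matrix (Fin n) (Fin n) ℝ) (μ : Fin n → ℝ),
      Vᵀ * Matrix.diagonal Γ * V = 1 ∧
      distLaplacianMatrix Γ x * V = Matrix.diagonal Γ * V * Matrix.diagonal μ := by
  set D : Matrix (Fin n) (Fin n) ℝ := Matrix.diagonal fun i => (Real.sqrt (Γ i))⁻¹ with hD
  set R : Matrix (Fin n) (Fin n) ℝ := Matrix.diagonal fun i => Real.sqrt (Γ i) with hR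
  have hs : ∀ i, Real.sqrt (Γ i) ≠ 0 := fun i => (Real.sqrt_pos.2 (hΓ i)).ne'
  have hDR : R * D = 1 := by
    rw [hD, hR, Matrix.diagonal_mul_diagonal, ← Matrix.diagonal_one]
    congr 1; funext i; exact mul_inv_cancel₀ (hs i)
  have hRR : R * R = Matrix.diagonal Γ := by
    rw [hR, Matrix.diagonal_mul_diagonal]
    congr 1; funext i; exact Real.mul_self_sqrt (hΓ i).le
  have hDt : Dᵀ = D := Matrix.diagonal_transpose _
  have hLt : (distLaplacianMatrix Γ x)ᵀ = distLaplacianMatrix Γ x := by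
    ext p q; exact distLaplacianMatrix_comm Γ x q p
  have hS : (D * distLaplacianMatrix Γ x * D).IsHermitian := by
    rw [Matrix.IsHermitian, Matrix.conjTranspose_eq_transpose_of_trivial, Matrix.transpose_mul,
      Matrix.transpose_mul, hDt, hLt, Matrix.mul_assoc]
  set U : Matrix (Fin n) (Fin n) ℝ := (hS.eigenvectorUnitary).1
  have hUU : Uᵀ * U = 1 := by
    have := Matrix.UnitaryGroup.star_mul_self hS.eigenvectorUnitary
    rwa [Matrix.star_eq_conjTranspose, Matrix.conjTranspose_eq_transpose_of_trivial] at this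
  obtain ⟨μ, hspec⟩ :
      ∃ μ, D * distLaplacianMatrix Γ x * D = U * Matrix.diagonal μ * Uᵀ := by
    refine ⟨hS.eigenvalues, ?_⟩
    have := hS.spectral_theorem
    simpa [Unitary.conjStarAlgAut_apply, Matrix.star_eq_conjTranspose,
      Matrix.conjTranspose_eq_transpose_of_trivial, Function.comp_def] using this
  refine ⟨D * U, μ, ?_, ?_⟩
  · rw [Matrix.transpose_mul, hDt, ← hRR]
    calc Uᵀ * D * (R * R) * (D * U) = Uᵀ * (D * R) * (R * D) * U := by
          simp only [Matrix.mul_assoc]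
      _ = 1 := by rw [hDR, mul_eq_one_comm.1 hDR, Matrix.mul_one, Matrix.mul_one, hUU]
  · calc distLaplacianMatrix Γ x * (D * U)
        = (R * D) * distLaplacianMatrix Γ x * D * U := by
          rw [hDR, Matrix.one_mul, Matrix.mul_assoc]
      _ = R * (D * distLaplacianMatrix Γ x * D) * U := by simp only [Matrix.mul_assoc]
      _ = R * U * Matrix.diagonal μ * (Uᵀ * U) := by
          rw [hspec]; simp only [Matrix.mul_assoc]
      _ = R * (R * D) * U * Matrix.diagonal μ := by
          rw [hUU, hDR, Matrix.mul_one, Matrix.mul_one]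
      _ = _ := by rw [← hRR]; simp only [Matrix.mul_assoc]

/-! ### Collinear relative equilibria -/

lemma symplJ_mul_self : symplJ * symplJ = -1 := by
  ext i j; fin_cases i <;> fin_cases j <;> simp [symplJ, Matrix.mul_apply]

lemma symplK_mul_self (n : ℕ) : symplK n * symplK n = -1 := by
  rw [symplK, ← Matrix.mul_kronecker_mul, symplJ_mul_self, Matrix.one_mul]
  ext ⟨i, s⟩ ⟨j, t⟩
  simp only [Matrix.kroneckerMap_apply, Matrix.neg_apply, Matrix.one_apply, Prod.mk.injEq]
  split_ifs <;> simp_all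

lemma circMatrix_eq_kronecker (Γ : Fin n → ℝ) :
    circMatrix Γ = Matrix.diagonal Γ ⊗ₖ (1 : Matrix (Fin 2) (Fin 2) ℝ) := by
  rw [← Matrix.diagonal_one, Matrix.diagonal_kronecker_diagonal, circMatrix]
  simp

lemma circMatrix_mulVec (Γ : Fin n → ℝ) (v : Fin n × Fin 2 → ℝ) (a : Fin n × Fin 2) :
    (circMatrix Γ *ᵥ v) a = Γ a.1 * v a := by
  simp [circMatrix, Matrix.mulVec_diagonal]

lemma circMatrix_mul_symplK (Γ : Fin n → ℝ) :
    circMatrix Γ * symplK n = symplK n * circMatrix Γ := by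
  rw [circMatrix_eq_kronecker, symplK, ← Matrix.mul_kronecker_mul, ← Matrix.mul_kronecker_mul]
  simp

lemma hasDerivAt_rotate (ω : ℝ) (z : Config n) :
    HasDerivAt (fun t => rotate (-ω * t) z)
      (WithLp.toLp 2 (-ω • (symplK n *ᵥ z.ofLp))) 0 := by
  have h1 : HasDerivAt (fun t : ℝ => -ω * t) (-ω) 0 := by
    simpa using (hasDerivAt_id (0 : ℝ)).const_mul (-ω)
  have hc := (h1.cos).smul_const z
  have hs := (h1.sin).smul_const (WithLp.toLp 2 (symplK n *ᵥ z.ofLp) : Config n)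
  have := hc.fun_add hs
  simp only [mul_zero, Real.sin_zero, Real.cos_zero, neg_zero, zero_mul, zero_smul, zero_add,
    one_mul] at this
  exact this

lemma rotate_zero (z : Config n) : rotate 0 z = z := by
  simp [rotate]

lemma IsRelativeEquilibrium.collisionFree {Γ : Fin n → ℝ} {ω : ℝ} {z : Config n}
    (h : IsRelativeEquilibrium Γ ω z) : CollisionFree z := by
  have := (h.2 0 (Set.mem_univ _)).1
  simpa only [mul_zero, rotate_zero] using this

/-- A relative equilibrium is a critical point of `H + ω I`: differentiate the rotation at `t = 0`
and use `K² = -1`. -/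
lemma IsRelativeEquilibrium.hamGrad_eq {Γ : Fin n → ℝ} {ω : ℝ} {z : Config n}
    (h : IsRelativeEquilibrium Γ ω z) (a : Fin n × Fin 2) :
    hamGrad Γ z a = -(ω * (Γ a.1 * z a)) := by
  obtain ⟨-, v, hv, heq⟩ := h.2 0 (Set.mem_univ _)
  simp only [mul_zero, rotate_zero] at heq
  rw [hv.unique (hasDerivAt_rotate ω z), gradient_hamiltonian Γ h.collisionFree] at heq
  have h2 := congrArg (fun w => symplK n *ᵥ w) heq
  simp only [Matrix.mulVec_smul, Matrix.mulVec_mulVec, circMatrix_mul_symplK] at h2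
  rw [← Matrix.mul_assoc, symplK_mul_self, Matrix.neg_mul, Matrix.one_mul, Matrix.neg_mulVec,
    Matrix.neg_mulVec, Matrix.one_mulVec] at h2
  have h3 := congrFun h2 a
  simp only [Pi.smul_apply, Pi.neg_apply, circMatrix_mulVec, smul_eq_mul] at h3
  linarith

/-- The centre of vorticity of a relative equilibrium is the origin. -/
lemma IsRelativeEquilibrium.sum_eq_zero {Γ : Fin n → ℝ} {ω : ℝ} {z : Config n}
    (h : IsRelativeEquilibrium Γ ω z) (t : Fin 2) : ∑ i, Γ i * z (i, t) = 0 := by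
  have h1 : ∑ i, hamGrad Γ z (i, t) = 0 := by
    simp only [hamGrad, Finset.sum_neg_distrib]
    have h2 : ∑ i, ∑ j, Γ i * Γ j * ((z (i, t) - z (j, t)) / sqDist i j z) =
        -∑ i, ∑ j, Γ i * Γ j * ((z (i, t) - z (j, t)) / sqDist i j z) := by
      conv_lhs => rw [Finset.sum_comm]
      simp only [← Finset.sum_neg_distrib]
      refine Finset.sum_congr rfl fun i _ => Finset.sum_congr rfl fun j _ => ?_
      rw [sqDist_comm]; ring
    linarith
  simp only [h.hamGrad_eq, Finset.sum_neg_distrib, ← Finset.mul_sum, neg_eq_zero] at h1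
  exact (mul_eq_zero.1 h1).resolve_left h.1

/-- A collinear relative equilibrium lies on a line through the origin, in the direction of a unit
vector `u`, and its coordinates on that line solve the one-dimensional equations. -/
lemma IsRelativeEquilibrium.exists_line {Γ : Fin n → ℝ} {ω : ℝ} {z : Config n}
    (h : IsRelativeEquilibrium Γ ω z) (hΓ : ∀ i, 0 < Γ i) (hn : 2 ≤ n) (hcol : IsCollinear z) :
    ∃ (u : Fin 2 → ℝ) (x : Fin n → ℝ), u 0 ^ 2 + u 1 ^ 2 = 1 ∧ (∀ a, z a = x a.1 * u a.2) ∧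
      IsCollinearEquilibrium Γ ω x := by
  obtain ⟨p, w, hw⟩ := (collinear_iff_exists_forall_eq_smul_vadd _).1 hcol
  have hr : ∀ i, ∃ r : ℝ, pos z i = r • w + p := fun i => hw _ ⟨i, rfl⟩
  choose r hr using hr
  have hz : ∀ i t, z (i, t) = r i * w t + p t := by
    intro i t
    have h1 := congrArg (fun q : EuclideanSpace ℝ (Fin 2) => q t) (hr i)
    have h2 : (pos z i) t = z (i, t) := by fin_cases t <;> simp [pos]
    rw [← h2]; simpa using h1
  have hΓs : 0 < ∑ i, Γ i :=
    Finset.sum_pos (fun i _ => hΓ i) ⟨⟨0, by omega⟩, Finset.mem_univ _⟩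
  set c : ℝ := (∑ i, Γ i * r i) / ∑ i, Γ i with hc
  have hp : ∀ t, p t = -c * w t := by
    intro t
    have h1 := h.sum_eq_zero t
    simp only [hz, mul_add, Finset.sum_add_distrib, ← Finset.sum_mul, ← mul_assoc] at h1
    rw [hc]; field_simp; linarith
  have hz' : ∀ i t, z (i, t) = (r i - c) * w t := fun i t => by rw [hz, hp]; ring
  have hcf := h.collisionFree
  have hw0 : 0 < w 0 ^ 2 + w 1 ^ 2 := by
    have h1 := hcf.sqDist_pos (i := ⟨0, by omega⟩) (j := ⟨1, by omega⟩) (by simp)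
    simp only [sqDist, hz'] at h1
    by_contra hcon
    have h2 : w 0 = 0 := by nlinarith [sq_nonneg (w 0), sq_nonneg (w 1)]
    have h3 : w 1 = 0 := by nlinarith [sq_nonneg (w 0), sq_nonneg (w 1)]
    simp [h2, h3] at h1
  set m := Real.sqrt (w 0 ^ 2 + w 1 ^ 2) with hm
  have hm0 : 0 < m := Real.sqrt_pos.2 hw0
  have hmm : m ^ 2 = w 0 ^ 2 + w 1 ^ 2 := Real.sq_sqrt hw0.le
  have hu : (w 0 / m) ^ 2 + (w 1 / m) ^ 2 = 1 := by
    rw [div_pow, div_pow, ← add_div, ← hmm]; field_simp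
  have hzx : ∀ a : Fin n × Fin 2, z a = (r a.1 - c) * m * (w a.2 / m) := by
    rintro ⟨i, t⟩; rw [hz']; field_simp
  refine ⟨fun t => w t / m, fun i => (r i - c) * m, hu, hzx, ?_, ?_⟩
  · intro i j hij
    by_contra hne
    have h1 := hcf.sqDist_pos hne
    simp only at hij
    simp [sqDist, hzx, hij] at h1
  · intro i
    set x := fun i => (r i - c) * m with hx
    set u := fun t => w t / m with hu'
    have hsq : ∀ j, sqDist i j z = (x i - x j) ^ 2 := by
      intro j
      simp only [sqDist, hzx]
      linear_combination (x i - x j) ^ 2 * hu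
    have key : ∀ t, ω * x i * u t = (∑ j, Γ j / (x i - x j)) * u t := by
      intro t
      have h1 := h.hamGrad_eq (i, t)
      simp only [hamGrad, hsq, hzx, neg_inj] at h1
      have h2 : ∀ j, Γ i * Γ j * (((r i - c) * m * (w t / m) - (r j - c) * m * (w t / m)) /
          (x i - x j) ^ 2) = Γ i * (Γ j / (x i - x j) * u t) := by
        intro j
        by_cases hij : x i - x j = 0
        · simp [hij]
        · rw [show (r i - c) * m * (w t / m) - (r j - c) * m * (w t / m) = (x i - x j) * u t by
            simp only [hx, hu']; ring]
          field_simp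
      rw [Finset.sum_congr rfl fun j _ => h2 j, ← Finset.mul_sum, ← Finset.sum_mul] at h1
      have h3 : Γ i * (ω * x i * u t) = Γ i * ((∑ j, Γ j / (x i - x j)) * u t) := by
        rw [h1]; simp only [hx, hu']; ring
      exact mul_left_cancel₀ (hΓ i).ne' h3
    linear_combination u 0 * key 0 + u 1 * key 1 + (-ω * x i + ∑ j, Γ j / (x i - x j)) * hu

/-- The reflection `2 u uᵀ - 1` of the plane, for a unit vector `u`. -/
def reflMatrix (u : Fin 2 → ℝ) : Matrix (Fin 2) (Fin 2) ℝ :=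
  Matrix.of fun s t => 2 * (u s * u t) - if s = t then 1 else 0

lemma sqDist_of_line {u : Fin 2 → ℝ} {x : Fin n → ℝ} {z : Config n}
    (hu : u 0 ^ 2 + u 1 ^ 2 = 1) (hz : ∀ a, z a = x a.1 * u a.2) (i j : Fin n) :
    sqDist i j z = (x i - x j) ^ 2 := by
  simp only [sqDist, hz]
  linear_combination (x i - x j) ^ 2 * hu

/-- On a line, the Hessian of the Hamiltonian splits into the Laplacian tensored with the
reflection in that line. -/
lemma hessian_hamiltonian_of_line {Γ : Fin n → ℝ} {u : Fin 2 → ℝ} {x : Fin n → ℝ} {z : Config n}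
    (hcf : CollisionFree z) (hu : u 0 ^ 2 + u 1 ^ 2 = 1) (hz : ∀ a, z a = x a.1 * u a.2) :
    hessian (hamiltonian Γ) z = distLaplacianMatrix Γ x ⊗ₖ reflMatrix u := by
  ext ⟨q, s⟩ ⟨p, t⟩
  rw [hessian_hamiltonian_apply Γ hcf]
  have hterm : ∀ j, ∃ f' : Config n →L[ℝ] ℝ,
      HasFDerivAt (fun z : Config n => Γ p * Γ j * ((z (p, t) - z (j, t)) / sqDist p j z)) f' z ∧
      f' (EuclideanSpace.single (q, s) 1) =
        -(Γ p * Γ j / (x p - x j) ^ 2 * reflMatrix u s t *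
          ((if p = q then 1 else 0) - if j = q then 1 else 0)) := by
    intro j
    by_cases hpj : p = j
    · subst hpj
      refine ⟨0, ?_, by simp⟩
      simp only [sub_self, zero_div, mul_zero]
      exact hasFDerivAt_const (0 : ℝ) z
    · have hne := (hcf.sqDist_pos hpj).ne'
      have hx : x p - x j ≠ 0 := by
        rw [sqDist_of_line hu hz] at hne
        exact fun h0 => hne (by rw [h0]; simp)
      simp only [div_eq_mul_inv (_ - _)]
      refine ⟨_, (((hasFDerivAt_coord (p, t) z).fun_sub (hasFDerivAt_coord (j, t) z)).fun_mul
        ((hasDerivAt_inv hne).comp_hasFDerivAt z (hasFDerivAt_sqDist p j z))).const_mul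
          (Γ p * Γ j), ?_⟩
      simp only [sqDist_of_line hu hz, hz, smul_apply, add_apply, sub_apply, PiLp.proj_apply,
        smul_eq_mul, EuclideanSpace.single, PiLp.single_apply, Prod.mk.injEq]
      simp only [Function.comp_apply, sqDist_of_line hu hz, ← sub_mul]
      fin_cases s <;> fin_cases t <;> by_cases h1 : p = q <;> by_cases h2 : j = q <;>
        simp [h1, h2, reflMatrix] <;> subst_vars <;> field_simp <;> ring
  choose f' hf' hf'v using hterm
  have := (HasFDerivAt.fun_sum (u := Finset.univ) fun j _ => hf' j).fun_neg
  rw [show (fun z => hamGrad Γ z (p, t)) = fun z : Config n =>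
    -∑ j, Γ p * Γ j * ((z (p, t) - z (j, t)) / sqDist p j z) from rfl, this.fderiv]
  simp only [neg_apply, sum_apply, hf'v, Finset.sum_neg_distrib, neg_neg,
    Matrix.kroneckerMap_apply, distLaplacianMatrix_comm Γ x q p]
  simp only [distLaplacianMatrix, Matrix.of_apply, mul_sub, Finset.sum_sub_distrib, mul_ite,
    mul_one, mul_zero, Finset.sum_ite_eq', Finset.mem_univ, if_true, sub_mul]
  split_ifs <;> simp [Finset.sum_mul]

/-! ### Diagonalisation of the linearised equations -/

/-- The diagonal entries of the Hessian of `H + ω I` in normal coordinates: `μₖ + ω` along the line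
and `ω - μₖ` across it. -/
def modeCoeff (ω : ℝ) (μ : Fin n → ℝ) (a : Fin n × Fin 2) : ℝ :=
  if a.2 = 0 then μ a.1 + ω else ω - μ a.1

/-- The rotation of the plane that takes the unit vector `u` to the first basis vector. -/
def frameMatrix (u : Fin 2 → ℝ) : Matrix (Fin 2) (Fin 2) ℝ := !![u 0, u 1; -u 1, u 0]

/-- `y = T v` are normal coordinates at `z`: they make `M` the identity and the Hessian of `H + ω I`
diagonal, and they commute with `K`. The modes `k₀` (translation) and `k₁` (rotation and scaling)
are trivial, and all others have `μₖ > ω`. -/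
structure IsNormalForm (Γ : Fin n → ℝ) (ω : ℝ) (z : Config n)
    (T : Matrix (Fin n × Fin 2) (Fin n × Fin 2) ℝ) (μ : Fin n → ℝ) (k₀ k₁ : Fin n) : Prop where
  isUnit_det : IsUnit T.det
  circMatrix_eq : circMatrix Γ = Tᵀ * T
  hessian_eq : hessian (lagrangian Γ ω) z = Tᵀ * Matrix.diagonal (modeCoeff ω μ) * T
  mul_stabilityMatrix :
    T * stabilityMatrix Γ ω z = symplK n * Matrix.diagonal (modeCoeff ω μ) * T
  mul_symplK : T * symplK n = symplK n * T
  omega_pos : 0 < ω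
  ne : k₀ ≠ k₁
  mu_translation : μ k₀ = 0
  mu_rotation : μ k₁ = ω
  lt_mu : ∀ k, k ≠ k₀ → k ≠ k₁ → ω < μ k
  mulVec_eq_zero : ∀ k s, k ≠ k₁ → (T *ᵥ z.ofLp) (k, s) = 0

/-- The eigenvalues of the Laplacian: `0` and `ω` are simple, the others exceed `ω`. -/
lemma IsCollinearEquilibrium.exists_spectrum {Γ x : Fin n → ℝ} {ω : ℝ}
    (h : IsCollinearEquilibrium Γ ω x) (hΓ : ∀ i, 0 < Γ i) (hn : 2 ≤ n) :
    ∃ (V : Matrix (Fin n) (Fin n) ℝ) (μ : Fin n → ℝ) (k₀ k₁ : Fin n),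
      Vᵀ * Matrix.diagonal Γ * V = 1 ∧
      distLaplacianMatrix Γ x * V = Matrix.diagonal Γ * V * Matrix.diagonal μ ∧
      k₀ ≠ k₁ ∧ μ k₀ = 0 ∧ μ k₁ = ω ∧ (∀ k, k ≠ k₀ → k ≠ k₁ → ω < μ k) ∧
      ∀ k, k ≠ k₁ → (Vᵀ *ᵥ (Matrix.diagonal Γ *ᵥ x)) k = 0 := by
  have hω := h.omega_pos hΓ hn
  obtain ⟨V, μ, hV, hL⟩ := exists_eigenbasis Γ x hΓ
  have horth : ∀ k l, ∑ i, Γ i * V i k * V i l = if k = l then 1 else 0 := by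
    intro k l
    have h1 := congrFun (congrFun hV k) l
    rw [Matrix.one_apply] at h1
    rw [← h1, Matrix.mul_apply]
    exact Finset.sum_congr rfl fun i _ => by
      rw [Matrix.mul_diagonal, Matrix.transpose_apply]; ring
  have heig : ∀ k i, distLaplacian Γ x (fun i => V i k) i = μ k * V i k := by
    intro k i
    have h1 := congrFun (congrFun hL i) k
    rw [Matrix.mul_diagonal, Matrix.diagonal_mul] at h1
    have h2 := distLaplacianMatrix_mulVec Γ x (fun i => V i k) i
    rw [Matrix.mul_apply] at h1
    rw [Matrix.mulVec, dotProduct, h1, mul_assoc] at h2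
    rw [← mul_left_cancel₀ (hΓ i).ne' h2, mul_comm]
  have hne : ∀ k, (fun i => V i k) ≠ 0 := by
    intro k h0
    have h1 := horth k k
    simp [show ∀ i, V i k = 0 from fun i => congrFun h0 i] at h1
  have htri := fun k => h.eigenvalue_trichotomy hΓ hω (hne k) (heig k)
  -- proportional columns coincide
  have huniq : ∀ (w : Fin n → ℝ) (k l : Fin n), (∃ c, ∀ i, V i k = c * w i) →
      (∃ c, ∀ i, V i l = c * w i) → k = l := by
    rintro w k l ⟨c, hc⟩ ⟨d, hd⟩
    by_contra hkl
    have h1 := horth k l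
    have h2 := horth k k
    have h3 := horth l l
    simp only [if_neg hkl, if_true, hc, hd] at h1 h2 h3
    have e : ∀ a b : ℝ, ∑ i, Γ i * (a * w i) * (b * w i) = a * b * ∑ i, Γ i * w i ^ 2 := by
      intro a b
      rw [Finset.mul_sum]
      exact Finset.sum_congr rfl fun i _ => by ring
    rw [e] at h1 h2 h3
    set S := ∑ i, Γ i * w i ^ 2
    have : (c * c * S) * (d * d * S) = 0 := by linear_combination (c * d * S) * h1
    rw [h2, h3] at this
    norm_num at this
  -- an eigenvector of the Laplacian is orthogonal to the eigenvectors of the other eigenvalues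
  have hself : ∀ (w : Fin n → ℝ) (ν : ℝ), (∀ i, distLaplacian Γ x w i = ν * w i) → ∀ k,
      (μ k - ν) * ∑ i, Γ i * V i k * w i = 0 := by
    intro w ν hw k
    have h1 : (fun i => V i k) ⬝ᵥ (distLaplacianMatrix Γ x *ᵥ w) =
        w ⬝ᵥ (distLaplacianMatrix Γ x *ᵥ fun i => V i k) := by
      rw [Matrix.dotProduct_mulVec, dotProduct_comm]
      congr 1
      funext p
      simp only [Matrix.vecMul, Matrix.mulVec, dotProduct]
      exact Finset.sum_congr rfl fun q _ => by rw [distLaplacianMatrix_comm Γ x q p, mul_comm]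
    simp only [dotProduct, distLaplacianMatrix_mulVec, hw, heig] at h1
    rw [sub_mul, Finset.mul_sum, Finset.mul_sum, sub_eq_zero]
    calc ∑ i, μ k * (Γ i * V i k * w i) = ∑ i, w i * (Γ i * (μ k * V i k)) :=
          Finset.sum_congr rfl fun i _ => by ring
      _ = ∑ i, V i k * (Γ i * (ν * w i)) := h1.symm
      _ = _ := Finset.sum_congr rfl fun i _ => by ring
  have hVV : V * (Vᵀ * Matrix.diagonal Γ) = 1 := mul_eq_one_comm.1 hV
  have hexists : ∀ (w : Fin n → ℝ) (ν : ℝ), w ≠ 0 → (∀ i, distLaplacian Γ x w i = ν * w i) →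
      ∃ k, μ k = ν := by
    intro w ν hw0 hw
    by_contra hcon
    push Not at hcon
    apply hw0
    have h1 : (Vᵀ * Matrix.diagonal Γ) *ᵥ w = 0 := by
      funext k
      have := (mul_eq_zero.1 (hself w ν hw k)).resolve_left (sub_ne_zero.2 (hcon k))
      rw [Matrix.mulVec, dotProduct, Pi.zero_apply, ← this]
      exact Finset.sum_congr rfl fun i _ => by
        rw [Matrix.mul_diagonal, Matrix.transpose_apply, mul_comm (V i k)]
    rw [← Matrix.one_mulVec w, ← hVV, ← Matrix.mulVec_mulVec, h1, Matrix.mulVec_zero]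
  obtain ⟨k₀, hk₀⟩ := hexists (fun _ => 1) 0
    (fun h0 => one_ne_zero (congrFun h0 ⟨0, by omega⟩))
    (fun i => by rw [distLaplacian_const]; ring)
  obtain ⟨k₁, hk₁⟩ := hexists x ω (fun h0 => by
    have := h.1 ((congrFun h0 ⟨0, by omega⟩).trans (congrFun h0 ⟨1, by omega⟩).symm)
    simp at this) h.distLaplacian_self
  have hone : ∀ k, μ k = 0 → ∃ c, ∀ i, V i k = c * (fun _ => (1 : ℝ)) i := by
    intro k hk
    rcases htri k with ⟨-, c, hc⟩ | ⟨h1, -⟩ | h1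
    · exact ⟨c, fun i => by simpa using hc i⟩
    · exact absurd (h1.symm.trans hk) hω.ne'
    · linarith
  have hx : ∀ k, μ k = ω → ∃ c, ∀ i, V i k = c * x i := by
    intro k hk
    rcases htri k with ⟨h1, -⟩ | ⟨-, h1⟩ | h1
    · exact absurd (hk.symm.trans h1) hω.ne'
    · exact h1
    · linarith
  refine ⟨V, μ, k₀, k₁, hV, hL, fun hk => ?_, hk₀, hk₁, fun k h0 h1 => ?_, fun k hk => ?_⟩
  · rw [hk, hk₁] at hk₀; exact hω.ne' hk₀
  · rcases htri k with ⟨h2, -⟩ | ⟨h2, -⟩ | h2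
    · exact absurd (huniq _ k k₀ (hone k h2) (hone k₀ hk₀)) h0
    · exact absurd (huniq _ k k₁ (hx k h2) (hx k₁ hk₁)) h1
    · exact h2
  · have hkω : μ k - ω ≠ 0 := sub_ne_zero.2 fun h2 => hk (huniq _ k k₁ (hx k h2) (hx k₁ hk₁))
    have := (mul_eq_zero.1 (hself x ω h.distLaplacian_self k)).resolve_left hkω
    rw [Matrix.mulVec, dotProduct, ← this]
    exact Finset.sum_congr rfl fun i _ => by
      rw [Matrix.mulVec_diagonal, Matrix.transpose_apply]; ring

lemma isUnit_det_circMatrix {Γ : Fin n → ℝ} (hΓ : ∀ i, 0 < Γ i) : IsUnit (circMatrix Γ).det := by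
  rw [circMatrix, Matrix.det_diagonal, isUnit_iff_ne_zero]
  exact Finset.prod_ne_zero_iff.2 fun a _ => (hΓ a.1).ne'

lemma stabilityMatrix_eq {Γ : Fin n → ℝ} (hΓ : ∀ i, 0 < Γ i) (ω : ℝ) {z : Config n}
    (hcf : CollisionFree z) :
    stabilityMatrix Γ ω z = symplK n * (circMatrix Γ)⁻¹ * hessian (lagrangian Γ ω) z := by
  rw [stabilityMatrix, hessian_lagrangian Γ ω hcf, Matrix.mul_assoc,
    Matrix.mul_add (circMatrix Γ)⁻¹, Matrix.mul_smul (circMatrix Γ)⁻¹,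
    Matrix.nonsing_inv_mul _ (isUnit_det_circMatrix hΓ)]

/-- Normal coordinates at a collinear relative equilibrium: the tensor product of the coordinates
in the eigenbasis of the Laplacian with the rotation of the line to the first axis. -/
lemma IsRelativeEquilibrium.exists_isNormalForm {Γ : Fin n → ℝ} {ω : ℝ} {z : Config n}
    (hre : IsRelativeEquilibrium Γ ω z) (hΓ : ∀ i, 0 < Γ i) (hn : 2 ≤ n) (hcol : IsCollinear z) :
    ∃ T μ k₀ k₁, IsNormalForm Γ ω z T μ k₀ k₁ := by
  obtain ⟨u, x, hu, hz, hx⟩ := hre.exists_line hΓ hn hcol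
  obtain ⟨V, μ, k₀, k₁, hV, hL, hne, hk₀, hk₁, hlt, hVx⟩ := hx.exists_spectrum hΓ hn
  have hcf := hre.collisionFree
  set D := Matrix.diagonal Γ with hD
  set W := Vᵀ * D with hW
  set R := frameMatrix u with hR
  have hDt : Dᵀ = D := Matrix.diagonal_transpose _
  have hWt : Wᵀ = D * V := by rw [hW, Matrix.transpose_mul, Matrix.transpose_transpose, hDt]
  have hVW : V * W = 1 := mul_eq_one_comm.1 hV
  have hRR : Rᵀ * R = 1 := by
    ext i j
    fin_cases i <;> fin_cases j <;>
      simp [hR, frameMatrix, Matrix.mul_apply, Fin.sum_univ_two] <;> first | ring1 | linear_combination hu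
  have hRJ : R * symplJ = symplJ * R := by
    ext i j
    fin_cases i <;> fin_cases j <;>
      simp [hR, frameMatrix, symplJ, Matrix.mul_apply, Fin.sum_univ_two]
  have hN : reflMatrix u = Rᵀ * Matrix.diagonal ![1, -1] * R := by
    ext i j
    fin_cases i <;> fin_cases j <;>
      simp [hR, frameMatrix, reflMatrix, Matrix.mul_apply, Fin.sum_univ_two,
        Matrix.diagonal_apply] <;> first | ring1 | linear_combination hu
  have hM : circMatrix Γ = (W ⊗ₖ R)ᵀ * (W ⊗ₖ R) := by
    rw [← Matrix.kroneckerMap_transpose, ← Matrix.mul_kronecker_mul, hRR, circMatrix_eq_kronecker,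
      hWt, Matrix.mul_assoc, hVW, Matrix.mul_one]
  have hLW : distLaplacianMatrix Γ x = Wᵀ * Matrix.diagonal μ * W := by
    rw [hWt, ← hL, Matrix.mul_assoc, hVW, Matrix.mul_one]
  have hΔ : Matrix.diagonal (modeCoeff ω μ) =
      Matrix.diagonal μ ⊗ₖ Matrix.diagonal ![1, -1] + ω • 1 := by
    ext ⟨i, s⟩ ⟨j, t⟩
    fin_cases s <;> fin_cases t <;> by_cases hij : i = j <;>
      (simp [modeCoeff, hij]; try ring)
  have hH : hessian (lagrangian Γ ω) z =
      (W ⊗ₖ R)ᵀ * Matrix.diagonal (modeCoeff ω μ) * (W ⊗ₖ R) := by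
    rw [hessian_lagrangian Γ ω hcf, hessian_hamiltonian_of_line hcf hu hz, hΔ, hM, hLW, hN,
      Matrix.mul_add, Matrix.add_mul, Matrix.mul_smul, Matrix.mul_one, Matrix.smul_mul,
      ← Matrix.kroneckerMap_transpose]
    simp only [← Matrix.mul_kronecker_mul]
  have hK : (W ⊗ₖ R) * symplK n = symplK n * (W ⊗ₖ R) := by
    rw [symplK, ← Matrix.mul_kronecker_mul, ← Matrix.mul_kronecker_mul, hRJ, Matrix.one_mul,
      Matrix.mul_one]
  have hunit : IsUnit (W ⊗ₖ R).det := by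
    have hl : (V ⊗ₖ Rᵀ) * (W ⊗ₖ R) = 1 := by
      rw [← Matrix.mul_kronecker_mul, hVW, hRR, Matrix.one_kronecker_one]
    exact Matrix.isUnit_det_of_left_inverse hl
  refine ⟨W ⊗ₖ R, μ, k₀, k₁, hunit, hM, hH, ?_, hK, hx.omega_pos hΓ hn, hne, hk₀, hk₁, hlt, ?_⟩
  · have h2 : (circMatrix Γ)⁻¹ * hessian (lagrangian Γ ω) z =
        (W ⊗ₖ R)⁻¹ * Matrix.diagonal (modeCoeff ω μ) * (W ⊗ₖ R) := by
      have htr : IsUnit (W ⊗ₖ R)ᵀ.det := by rwa [Matrix.det_transpose]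
      rw [hM, hH, Matrix.mul_inv_rev]
      simp only [Matrix.mul_assoc]
      rw [Matrix.nonsing_inv_mul_cancel_left _ _ htr]
    rw [stabilityMatrix_eq hΓ ω hcf, Matrix.mul_assoc (symplK n), h2, ← Matrix.mul_assoc, hK, Matrix.mul_assoc, Matrix.mul_assoc, Matrix.mul_assoc,
      Matrix.mul_nonsing_inv_cancel_left _ _ hunit]
  · intro k s hk
    have h1 : ((W ⊗ₖ R) *ᵥ z.ofLp) (k, s) = (W *ᵥ x) k * (R *ᵥ u) s := by
      simp only [Matrix.mulVec, dotProduct, Matrix.kroneckerMap_apply, Fintype.sum_prod_type, hz,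
        Finset.sum_mul_sum]
      exact Finset.sum_congr rfl fun i _ => Finset.sum_congr rfl fun t _ => by ring
    rw [h1, hW, ← Matrix.mulVec_mulVec, hVx k hk, zero_mul]

/-! ### Eigenvalues and Morse index -/

/-- The nontrivial modes, as a type. -/
abbrev NontrivialMode (k₀ k₁ : Fin n) : Type := {k : Fin n // k ≠ k₀ ∧ k ≠ k₁}

lemma card_nontrivialMode {k₀ k₁ : Fin n} (h : k₀ ≠ k₁) :
    Fintype.card (NontrivialMode k₀ k₁) = n - 2 := by
  have h1 : (Finset.univ.filter fun k : Fin n => k ≠ k₀ ∧ k ≠ k₁) =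
      (Finset.univ.erase k₀).erase k₁ := by
    ext k; simp [and_comm]
  rw [Fintype.card_subtype, h1, Finset.card_erase_of_mem (by simp [h.symm]),
    Finset.card_erase_of_mem (Finset.mem_univ _), Finset.card_univ, Fintype.card_fin]
  omega

lemma sum_eq_add_add_sum_nontrivialMode {k₀ k₁ : Fin n} (h : k₀ ≠ k₁) {β : Type*}
    [AddCommMonoid β] (f : Fin n → β) :
    ∑ k, f k = f k₀ + f k₁ + ∑ k : NontrivialMode k₀ k₁, f k := by
  have h1 : (Finset.univ.filter fun k : Fin n => k ≠ k₀ ∧ k ≠ k₁) =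
      (Finset.univ.erase k₀).erase k₁ := by
    ext k; simp [and_comm]
  have h2 : ∑ k : NontrivialMode k₀ k₁, f k = ∑ k ∈ (Finset.univ.erase k₀).erase k₁, f k := by
    rw [← h1]; exact (Finset.sum_subtype _ (by simp) f).symm
  rw [h2, add_assoc, Finset.add_sum_erase _ _ (by simp [h.symm]),
    Finset.add_sum_erase _ _ (Finset.mem_univ _)]

open Polynomial in
lemma charpoly_symplK_mul_diagonal (ω : ℝ) (μ : Fin n → ℝ) :
    (symplK n * Matrix.diagonal (modeCoeff ω μ)).charpoly =
      ∏ k, (X ^ 2 + C (ω ^ 2 - μ k ^ 2)) := by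
  have h1 : symplK n * Matrix.diagonal (modeCoeff ω μ) =
      Matrix.reindex (Equiv.prodComm _ _) (Equiv.prodComm _ _)
        (Matrix.blockDiagonal fun k => !![0, ω - μ k; -(μ k + ω), 0]) := by
    ext ⟨i, s⟩ ⟨j, t⟩
    rw [Matrix.mul_diagonal]
    fin_cases s <;> fin_cases t <;> by_cases hij : i = j <;>
      simp [symplK, symplJ, modeCoeff, hij, Matrix.blockDiagonal_apply]
  have h2 : ∀ M : Fin n → Matrix (Fin 2) (Fin 2) ℝ,
      (Matrix.blockDiagonal M).charmatrix = Matrix.blockDiagonal fun k => (M k).charmatrix := by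
    intro M
    ext ⟨s, i⟩ ⟨t, j⟩ : 1
    by_cases hij : i = j
    · subst hij
      simp [Matrix.charmatrix_apply, Matrix.blockDiagonal_apply, Matrix.diagonal_apply]
    · simp [Matrix.blockDiagonal_apply, hij]
  rw [h1, Matrix.charpoly_reindex, Matrix.charpoly, h2, Matrix.det_blockDiagonal]
  refine Finset.prod_congr rfl fun k _ => ?_
  rw [Matrix.det_fin_two]
  simp
  ring

lemma IsNormalForm.stabilityMatrix_charpoly {Γ : Fin n → ℝ} {ω : ℝ} {z : Config n}
    {T : Matrix (Fin n × Fin 2) (Fin n × Fin 2) ℝ} {μ : Fin n → ℝ} {k₀ k₁ : Fin n}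
    (h : IsNormalForm Γ ω z T μ k₀ k₁) :
    (stabilityMatrix Γ ω z).charpoly =
      (symplK n * Matrix.diagonal (modeCoeff ω μ)).charpoly := by
  have h1 : stabilityMatrix Γ ω z =
      T⁻¹ * (symplK n * Matrix.diagonal (modeCoeff ω μ) * T) := by
    rw [← h.mul_stabilityMatrix, Matrix.nonsing_inv_mul_cancel_left _ _ h.isUnit_det]
  rw [h1, Matrix.charpoly_mul_comm, Matrix.mul_assoc, Matrix.mul_nonsing_inv _ h.isUnit_det,
    Matrix.mul_one]

open Polynomial in
/-- Each mode contributes the pair `± √(μₖ² - ω²)` of eigenvalues. -/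
lemma IsNormalForm.eigenvalues_eq {Γ : Fin n → ℝ} {ω : ℝ} {z : Config n}
    {T : Matrix (Fin n × Fin 2) (Fin n × Fin 2) ℝ} {μ : Fin n → ℝ} {k₀ k₁ : Fin n}
    (h : IsNormalForm Γ ω z T μ k₀ k₁) (r : Fin n → ℂ)
    (hr : ∀ k, r k ^ 2 = (μ k : ℂ) ^ 2 - (ω : ℂ) ^ 2) :
    eigenvalues Γ ω z = ∑ k, ({r k, -r k} : Multiset ℂ) := by
  have h1 : ((stabilityMatrix Γ ω z).map (algebraMap ℝ ℂ)).charpoly =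
      ∏ k, ((X - C (r k)) * (X - C (-r k))) := by
    rw [Matrix.charpoly_map, h.stabilityMatrix_charpoly, charpoly_symplK_mul_diagonal,
      Polynomial.map_prod]
    refine Finset.prod_congr rfl fun k _ => ?_
    have h2 : (X - C (r k)) * (X - C (-r k)) = X ^ 2 - C (r k ^ 2) := by
      rw [C_neg, C_pow]; ring
    rw [h2, hr]
    simp
    ring
  have hne : ∀ k, (X - C (r k)) * (X - C (-r k)) ≠ 0 :=
    fun k => mul_ne_zero (X_sub_C_ne_zero _) (X_sub_C_ne_zero _)
  rw [eigenvalues, h1, Polynomial.roots_prod _ _ (Finset.prod_ne_zero_iff.2 fun k _ => hne k)]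
  change ∑ k, ((X - C (r k)) * (X - C (-r k))).roots = _
  refine Finset.sum_congr rfl fun k _ => ?_
  rw [roots_mul (hne k), roots_X_sub_C, roots_X_sub_C]
  rfl

lemma IsNormalForm.nontrivialEigenvalues_eq {Γ : Fin n → ℝ} {ω : ℝ} {z : Config n}
    {T : Matrix (Fin n × Fin 2) (Fin n × Fin 2) ℝ} {μ : Fin n → ℝ} {k₀ k₁ : Fin n}
    (h : IsNormalForm Γ ω z T μ k₀ k₁) :
    ∃ α : Fin (n - 2) → ℝ, (∀ j, 0 < α j) ∧
      nontrivialEigenvalues Γ ω z = ∑ j, ({(α j : ℂ), -(α j : ℂ)} : Multiset ℂ) := by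
  have hpos : ∀ k : NontrivialMode k₀ k₁, 0 < μ k ^ 2 - ω ^ 2 := fun k => by
    have := h.lt_mu k k.2.1 k.2.2
    have := h.omega_pos
    nlinarith
  set r : Fin n → ℂ := fun k => if k = k₀ then (ω : ℂ) * Complex.I else if k = k₁ then 0 else
    (Real.sqrt (μ k ^ 2 - ω ^ 2) : ℝ) with hrdef
  have hrk : ∀ k : NontrivialMode k₀ k₁, r k = (Real.sqrt (μ k ^ 2 - ω ^ 2) : ℝ) := fun k => by
    simp [hrdef, k.2.1, k.2.2]
  have hr : ∀ k, r k ^ 2 = (μ k : ℂ) ^ 2 - (ω : ℂ) ^ 2 := by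
    intro k
    by_cases hk0 : k = k₀
    · simp [hrdef, hk0, h.mu_translation, mul_pow]
    by_cases hk1 : k = k₁
    · simp [hrdef, hk1, h.ne.symm, h.mu_rotation]
    rw [hrk ⟨k, hk0, hk1⟩, ← Complex.ofReal_pow, Real.sq_sqrt (hpos ⟨k, hk0, hk1⟩).le]
    push_cast; rfl
  let e : Fin (n - 2) ≃ NontrivialMode k₀ k₁ :=
    (Fintype.equivFinOfCardEq (card_nontrivialMode h.ne)).symm
  refine ⟨fun j => Real.sqrt (μ (e j) ^ 2 - ω ^ 2), fun j => Real.sqrt_pos.2 (hpos _), ?_⟩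
  rw [nontrivialEigenvalues, h.eigenvalues_eq r hr, sum_eq_add_add_sum_nontrivialMode h.ne]
  have h0 : ({r k₀, -r k₀} : Multiset ℂ) + {r k₁, -r k₁} =
      {0, 0, (ω : ℂ) * Complex.I, -((ω : ℂ) * Complex.I)} := by
    simp only [hrdef, if_true, h.ne.symm, if_false, neg_zero]
    rw [add_comm]; rfl
  rw [h0, add_tsub_cancel_left]
  simp only [hrk]
  exact (e.sum_comp fun k : NontrivialMode k₀ k₁ =>
    ({((Real.sqrt (μ k ^ 2 - ω ^ 2) : ℝ) : ℂ), -((Real.sqrt (μ k ^ 2 - ω ^ 2) : ℝ) : ℂ)} :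
      Multiset ℂ)).symm

lemma IsNormalForm.hessian_form {Γ : Fin n → ℝ} {ω : ℝ} {z : Config n}
    {T : Matrix (Fin n × Fin 2) (Fin n × Fin 2) ℝ} {μ : Fin n → ℝ} {k₀ k₁ : Fin n}
    (h : IsNormalForm Γ ω z T μ k₀ k₁) (v : Fin n × Fin 2 → ℝ) :
    v ⬝ᵥ (hessian (lagrangian Γ ω) z *ᵥ v) = ∑ a, modeCoeff ω μ a * (T *ᵥ v) a ^ 2 := by
  rw [h.hessian_eq, Matrix.mul_assoc, ← Matrix.mulVec_mulVec, Matrix.dotProduct_mulVec,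
    Matrix.vecMul_transpose, ← Matrix.mulVec_mulVec, dotProduct]
  exact Finset.sum_congr rfl fun a _ => by rw [Matrix.mulVec_diagonal]; ring

/-- The form is negative exactly across the line in the nontrivial modes, and these directions are
tangent to the level surface. -/
lemma IsNormalForm.morseIndex_eq {Γ : Fin n → ℝ} {ω : ℝ} {z : Config n}
    {T : Matrix (Fin n × Fin 2) (Fin n × Fin 2) ℝ} {μ : Fin n → ℝ} {k₀ k₁ : Fin n}
    (h : IsNormalForm Γ ω z T μ k₀ k₁) : morseIndex Γ ω z = n - 2 := by
  have hinj : Function.Injective fun k : NontrivialMode k₀ k₁ => ((k : Fin n), (1 : Fin 2)) :=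
    fun k l hkl => Subtype.ext (Prod.ext_iff.1 hkl).1
  refine IsGreatest.csSup_eq ⟨?_, ?_⟩
  · set φ : (NontrivialMode k₀ k₁ → ℝ) →ₗ[ℝ] (Fin n × Fin 2 → ℝ) :=
      T⁻¹.mulVecLin ∘ₗ Function.ExtendByZero.linearMap ℝ
        (fun k : NontrivialMode k₀ k₁ => ((k : Fin n), (1 : Fin 2))) with hφ
    have hTφ : ∀ c, T *ᵥ (φ c) = Function.extend
        (fun k : NontrivialMode k₀ k₁ => ((k : Fin n), (1 : Fin 2))) c 0 := by
      intro c
      simp only [hφ, LinearMap.comp_apply, Matrix.mulVecLin_apply, Matrix.mulVec_mulVec,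
        Matrix.mul_nonsing_inv _ h.isUnit_det, Matrix.one_mulVec]
      rfl
    have hon : ∀ c k, (T *ᵥ (φ c)) (k.1, 1) = c k := fun c k => by
      rw [hTφ]; exact hinj.extend_apply c 0 k
    have hoff : ∀ c a, (∀ k : NontrivialMode k₀ k₁, ((k : Fin n), (1 : Fin 2)) ≠ a) →
        (T *ᵥ (φ c)) a = 0 := fun c a ha => by
      rw [hTφ, Function.extend_apply' _ _ _ fun ⟨k, hk⟩ => ha k hk]; rfl
    have hφinj : Function.Injective φ := fun c d hcd => by
      funext k; rw [← hon c, ← hon d, hcd]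
    refine ⟨LinearMap.range φ, ?_, ?_, ?_⟩
    · rintro _ ⟨c, rfl⟩
      change φ c ⬝ᵥ (circMatrix Γ *ᵥ z.ofLp) = 0
      rw [h.circMatrix_eq, ← Matrix.mulVec_mulVec, Matrix.dotProduct_mulVec,
        Matrix.vecMul_transpose]
      refine Finset.sum_eq_zero fun ⟨k, s⟩ _ => ?_
      by_cases hk : k = k₁
      · rw [hoff c, zero_mul]
        exact fun l hl => l.2.2 ((Prod.ext_iff.1 hl).1.trans hk)
      · rw [h.mulVec_eq_zero k s hk, mul_zero]
    · rintro _ ⟨c, rfl⟩ hc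
      have hc0 : c ≠ 0 := fun h0 => hc (by rw [h0, map_zero])
      obtain ⟨k, hk⟩ := Function.ne_iff.1 hc0
      rw [h.hessian_form]
      have hle : ∀ a, modeCoeff ω μ a * (T *ᵥ (φ c)) a ^ 2 ≤ 0 := by
        intro a
        by_cases ha : ∃ l : NontrivialMode k₀ k₁, ((l : Fin n), (1 : Fin 2)) = a
        · obtain ⟨l, rfl⟩ := ha
          have := h.lt_mu l l.2.1 l.2.2
          exact mul_nonpos_of_nonpos_of_nonneg (by simp [modeCoeff]; linarith) (sq_nonneg _)
        · rw [hoff c a (by simpa using ha)]; simp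
      refine Finset.sum_neg' (fun a _ => hle a) ⟨(k.1, 1), Finset.mem_univ _, ?_⟩
      rw [hon]
      have := h.lt_mu k k.2.1 k.2.2
      have h2 : c k ≠ 0 := hk
      exact mul_neg_of_neg_of_pos (by simp [modeCoeff]; linarith) (by positivity)
    · rw [LinearMap.finrank_range_of_inj hφinj, Module.finrank_fintype_fun_eq_card,
        card_nontrivialMode h.ne]
  · rintro m ⟨W, -, hneg, rfl⟩
    set ψ : W →ₗ[ℝ] (NontrivialMode k₀ k₁ → ℝ) :=
      LinearMap.funLeft ℝ ℝ (fun k : NontrivialMode k₀ k₁ => ((k : Fin n), (1 : Fin 2))) ∘ₗ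
        T.mulVecLin ∘ₗ W.subtype with hψ
    have hψinj : Function.Injective ψ := by
      rw [← LinearMap.ker_eq_bot, LinearMap.ker_eq_bot']
      rintro ⟨v, hv⟩ hv0
      have hzero : ∀ k : NontrivialMode k₀ k₁, (T *ᵥ v) (k.1, 1) = 0 := fun k => congrFun hv0 k
      by_contra hcon
      have hlt := hneg v hv (fun h0 => hcon (Subtype.ext h0))
      rw [h.hessian_form] at hlt
      refine absurd hlt (not_lt.2 (Finset.sum_nonneg fun ⟨k, s⟩ _ => ?_))
      have hω := h.omega_pos
      by_cases hk0 : k = k₀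
      · refine mul_nonneg ?_ (sq_nonneg _)
        rw [hk0]
        fin_cases s <;> simp [modeCoeff, h.mu_translation, hω.le]
      by_cases hk1 : k = k₁
      · refine mul_nonneg ?_ (sq_nonneg _)
        rw [hk1]
        fin_cases s <;> simp [modeCoeff, h.mu_rotation, hω.le]
      have hμ := h.lt_mu k hk0 hk1
      fin_cases s
      · exact mul_nonneg (by simp [modeCoeff]; linarith) (sq_nonneg _)
      · have h0 := hzero ⟨k, hk0, hk1⟩
        simp only at h0
        simp [h0]
    have := LinearMap.finrank_le_finrank_of_injective hψinj
    rwa [Module.finrank_fintype_fun_eq_card, card_nontrivialMode h.ne] at this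

/-! ### Instability of an equilibrium with a positive eigenvalue -/

section Instability

variable {E : Type*} [NormedAddCommGroup E] [NormedSpace ℝ E]

/-- A `C²` vector field near an equilibrium `z` agrees there with a bounded and globally Lipschitz
field whose deviation from the linearisation is globally quadratic. -/
lemma exists_cutoff [FiniteDimensional ℝ E] {F : E → E} {z : E} (hF : ContDiffAt ℝ 2 F z)
    (hz : F z = 0) {U : Set E} (hU : U ∈ nhds z) :
    ∃ (F' : E → E) (r : ℝ) (K L : NNReal) (C : ℝ), 0 < r ∧ 0 < C ∧
      (∀ y, ‖y - z‖ < r → y ∈ U ∧ F' y = F y) ∧ LipschitzWith K F' ∧ (∀ y, ‖F' y‖ ≤ L) ∧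
      ∀ y, ‖F' y - fderiv ℝ F z (y - z)‖ ≤ C * ‖y - z‖ ^ 2 := by
  obtain ⟨R, hR, hRF⟩ := Metric.eventually_nhds_iff_ball.1
    ((hF.eventually (by norm_num)).and hU)
  let f : ContDiffBump z := ⟨R / 3, R / 2, by positivity, by linarith⟩
  set F' : E → E := fun y => f y • F y with hF'
  have hin : ∀ y, ‖y - z‖ < R / 3 → F' y = F y := fun y hy => by
    simp only [hF']
    rw [f.one_of_mem_closedBall (by simpa [dist_eq_norm] using hy.le), one_smul]
  have hsupp : ∀ y, y ∉ Metric.closedBall z (R / 2) → F' y = 0 := fun y hy => by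
    simp only [hF']
    rw [f.zero_of_le_dist (by simpa using (not_le.1 hy).le), zero_smul]
  have hcomp : HasCompactSupport F' :=
    HasCompactSupport.intro (isCompact_closedBall z (R / 2)) hsupp
  have hsmooth : ContDiff ℝ 2 F' := by
    rw [contDiff_iff_contDiffAt]
    intro y
    by_cases hy : y ∈ Metric.ball z R
    · exact f.contDiffAt.smul (hRF y hy).1
    · have hy' : y ∈ (Metric.closedBall z (R / 2))ᶜ := fun h => hy
        (Metric.closedBall_subset_ball (by linarith) h)
      have : F' =ᶠ[nhds y] fun _ => 0 := by
        filter_upwards [Metric.isClosed_closedBall.isOpen_compl.mem_nhds hy'] with w hw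
        exact hsupp w hw
      exact contDiffAt_const.congr_of_eventuallyEq this
  have hnear : F' =ᶠ[nhds z] F := by
    filter_upwards [Metric.ball_mem_nhds z (show 0 < R / 3 by positivity)] with y hy
    exact hin y (by simpa [dist_eq_norm] using hy)
  have hdsmooth : ContDiff ℝ 1 (fderiv ℝ F') := hsmooth.fderiv_right (by norm_num)
  obtain ⟨K, hK⟩ := hsmooth.lipschitzWith_of_hasCompactSupport hcomp (by norm_num)
  obtain ⟨K₂, hK₂⟩ := hdsmooth.lipschitzWith_of_hasCompactSupport (hcomp.fderiv ℝ) (by norm_num)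
  obtain ⟨L, hL⟩ := hcomp.exists_bound_of_continuous hsmooth.continuous
  refine ⟨F', R / 3, K, L.toNNReal, K₂ + 1, by positivity, by positivity, fun y hy => ⟨?_, hin y hy⟩,
    hK, fun y => (hL y).trans (Real.le_coe_toNNReal L), fun y => ?_⟩
  · exact (hRF y (by rw [Metric.mem_ball, dist_eq_norm]; linarith)).2
  · have hz' : F' z = 0 := by rw [hnear.eq_of_nhds, hz]
    have h1 := (convex_closedBall z ‖y - z‖).norm_image_sub_le_of_norm_fderiv_le'
      (𝕜 := ℝ) (f := F') (φ := fderiv ℝ F z) (C := K₂ * ‖y - z‖) (x := z) (y := y)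
      (fun x _ => (hsmooth.differentiable (by norm_num)) x) (fun x hx => ?_)
      (by simp) (by simp [dist_eq_norm])
    · rw [hz', sub_zero] at h1
      nlinarith [sq_nonneg ‖y - z‖]
    · rw [← hnear.fderiv_eq]
      refine (hK₂.norm_sub_le x z).trans ?_
      rw [Metric.mem_closedBall, dist_eq_norm] at hx
      gcongr

/-- A bounded and globally Lipschitz field has solutions on arbitrarily long time intervals. -/
lemma exists_solution_of_bounded [FiniteDimensional ℝ E] {F : E → E} {K L : NNReal}
    (hK : LipschitzWith K F) (hL : ∀ y, ‖F y‖ ≤ L) (y : E) {τ : ℝ} (hτ : 0 ≤ τ) :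
    ∃ ζ : ℝ → E, ζ 0 = y ∧ ∀ t ∈ Set.Ioo (-τ) τ, HasDerivAt ζ (F (ζ t)) t := by
  have hpl : IsPicardLindelof (fun _ => F) (tmin := -τ) (tmax := τ)
      ⟨0, by simpa using hτ, hτ⟩ y (L * ⟨τ, hτ⟩) 0 L K := by
    refine IsPicardLindelof.of_time_independent (fun x _ => hL x) hK.lipschitzOnWith ?_
    simp only [sub_zero, sub_neg_eq_add, zero_add, max_self, NNReal.coe_zero]
    exact le_rfl
  obtain ⟨ζ, h0, hζ⟩ := hpl.exists_eq_forall_mem_Icc_hasDerivWithinAt₀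
  exact ⟨ζ, h0, fun t ht =>
    (hζ t (Set.Ioo_subset_Icc_self ht)).hasDerivAt (Icc_mem_nhds ht.1 ht.2)⟩

/-- A differential inequality `E' ≤ 2 C e^{α t} E^{3/2}` with small initial value keeps `E` bounded
by a multiple of its initial value as long as `(C / α) e^{α t}` is small. -/
lemma le_of_deriv_le_sqrt_pow {e e' : ℝ → ℝ} {α C s τ : ℝ} (hα : 0 < α) (hC : 0 ≤ C) (hs : 0 < s)
    (hnn : ∀ t, 0 ≤ e t) (h0 : e 0 ≤ s ^ 2)
    (hd : ∀ t ∈ Set.Ico 0 τ, HasDerivAt e (e' t) t)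
    (hle : ∀ t ∈ Set.Ico 0 τ, e' t ≤ 2 * C * Real.exp (α * t) * Real.sqrt (e t) ^ 3)
    {t : ℝ} (ht : t ∈ Set.Ico 0 τ) (hsmall : C / α * Real.exp (α * t) ≤ 1 / (4 * s)) :
    e t ≤ 16 * s ^ 2 := by
  -- the shift by `3 s²` keeps the square root away from `0`
  set q : ℝ → ℝ := fun t => Real.sqrt (e t + 3 * s ^ 2)
  have hqpos : ∀ t, 0 < q t := fun t => Real.sqrt_pos.2 (by have := hnn t; positivity)
  have hder : ∀ t ∈ Set.Ico 0 τ, HasDerivAt (fun t => (q t)⁻¹ + C / α * Real.exp (α * t))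
      (-(e' t / (2 * q t)) / q t ^ 2 + C * Real.exp (α * t)) t := by
    intro t ht
    have h1 : HasDerivAt q (e' t / (2 * q t)) t :=
      ((hd t ht).add_const _).sqrt (by have := hnn t; positivity)
    have h2 : HasDerivAt (fun t => Real.exp (α * t)) (Real.exp (α * t) * α) t := by
      simpa using ((hasDerivAt_id t).const_mul α).exp
    refine ((h1.fun_inv (hqpos t).ne').fun_add (h2.const_mul (C / α))).congr_deriv ?_
    field_simp
  have hmono : MonotoneOn (fun t => (q t)⁻¹ + C / α * Real.exp (α * t)) (Set.Ico 0 τ) := by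
    refine monotoneOn_of_hasDerivWithinAt_nonneg (convex_Ico 0 τ)
      (fun t ht => (hder t ht).continuousAt.continuousWithinAt)
      (fun t ht => (hder t (interior_subset ht)).hasDerivWithinAt) fun t ht => ?_
    have ht := interior_subset ht
    have h1 : Real.sqrt (e t) ≤ q t := Real.sqrt_le_sqrt (by nlinarith)
    have h2 : e' t ≤ 2 * C * Real.exp (α * t) * q t ^ 3 :=
      (hle t ht).trans (by gcongr)
    have h3 : e' t / (2 * q t) / q t ^ 2 ≤ C * Real.exp (α * t) := by
      rw [div_div, div_le_iff₀ (by have := hqpos t; positivity)]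
      nlinarith
    rw [neg_div]
    linarith
  have hτ : (0 : ℝ) ∈ Set.Ico 0 τ := ⟨le_rfl, ht.1.trans_lt ht.2⟩
  have h1 := hmono hτ ht ht.1
  have hq0 : q 0 ≤ 2 * s := Real.sqrt_le_iff.2 ⟨by positivity, by nlinarith⟩
  have h2 : 1 / (2 * s) ≤ (q 0)⁻¹ := by
    rw [one_div]; exact inv_anti₀ (hqpos 0) hq0
  have h3 : 0 ≤ C / α * Real.exp (α * 0) := by positivity
  have h4 : 1 / (2 * s) = 1 / (4 * s) + 1 / (4 * s) := by field_simp; norm_num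
  have h5 : (4 * s)⁻¹ ≤ (q t)⁻¹ := by
    rw [← one_div]; simp only at h1; linarith
  have h6 : q t ≤ 4 * s := (inv_le_inv₀ (by positivity) (hqpos t)).1 h5
  have h7 := (Real.sqrt_le_iff.1 h6).2
  nlinarith

variable {G : Type*} [NormedAddCommGroup G] [InnerProductSpace ℝ G]

/-- Growth of a solution of `ξ' = B ξ + O(‖ξ‖²)`, when `α` bounds the growth rate of the linear
equation in the Euclidean norm `‖T ξ‖` and `ℓ` is a left eigenvector of `B` for `α`: as long as
`d e^{α t}` stays below a threshold, the solution is of the order of `d e^{α t}`, and so is `ℓ`. -/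
lemma growth_estimate {B : E →L[ℝ] E} {T : E →L[ℝ] G} {ℓ : E →L[ℝ] ℝ} {α c C : ℝ}
    (hα : 0 < α) (hc : 0 < c) (hC : 0 < C) (hT : ∀ v, c * ‖v‖ ≤ ‖T v‖)
    (hTB : ∀ v, inner ℝ (T v) (T (B v)) ≤ α * ‖T v‖ ^ 2) (hℓ : ∀ v, ℓ (B v) = α * ℓ v)
    {e : E} (he : ℓ e = 1) :
    ∃ κ > 0, ∃ A > 0, ∀ (d τ : ℝ) (ξ ξ' : ℝ → E), 0 < d → ξ 0 = d • e →
      (∀ t ∈ Set.Ico 0 τ, HasDerivAt ξ (ξ' t) t ∧ ‖ξ' t - B (ξ t)‖ ≤ C * ‖ξ t‖ ^ 2) →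
      ∀ t ∈ Set.Ico 0 τ, d * Real.exp (α * t) ≤ κ →
        ‖ξ t‖ ≤ A * (d * Real.exp (α * t)) ∧ d * Real.exp (α * t) / 2 ≤ ℓ (ξ t) := by
  have he0 : e ≠ 0 := fun h0 => by simp [h0] at he
  have hTe : 0 < ‖T e‖ := lt_of_lt_of_le (mul_pos hc (norm_pos_iff.2 he0)) (hT e)
  set N := ‖T e‖ with hN
  set C₁ := ‖T‖ * C / c ^ 2 with hC₁
  have hC₁nn : 0 ≤ C₁ := by positivity
  set D := ‖ℓ‖ * C * (4 * N / c) ^ 2 with hD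
  have hDnn : 0 ≤ D := by positivity
  refine ⟨min (α / (4 * N * (C₁ + 1))) (α / (2 * (D + 1))), by positivity, 4 * N / c,
    by positivity, ?_⟩
  intro d τ ξ ξ' hd h0 hξ
  have hexp : ∀ a t : ℝ, HasDerivAt (fun t => Real.exp (a * t)) (Real.exp (a * t) * a) t := by
    intro a t; simpa using ((hasDerivAt_id t).const_mul a).exp
  have hee : ∀ t, Real.exp (-α * t) * Real.exp (α * t) = 1 := fun t => by
    rw [← Real.exp_add]; simp
  have hnorm : ∀ t ∈ Set.Ico 0 τ,
      d * Real.exp (α * t) ≤ min (α / (4 * N * (C₁ + 1))) (α / (2 * (D + 1))) →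
      ‖ξ t‖ ≤ 4 * N / c * (d * Real.exp (α * t)) := by
    intro t ht hκ
    have hwd : ∀ t ∈ Set.Ico 0 τ, HasDerivAt (fun t => Real.exp (-α * t) • T (ξ t))
        (Real.exp (-α * t) • (T (ξ' t) - α • T (ξ t))) t := by
      intro t ht
      refine ((hexp (-α) t).fun_smul (T.hasFDerivAt.comp_hasDerivAt t (hξ t ht).1)).congr_deriv ?_
      simp only [Function.comp_apply]
      module
    have hE := le_of_deriv_le_sqrt_pow (e := fun t => ‖Real.exp (-α * t) • T (ξ t)‖ ^ 2)
      (e' := fun t => 2 * inner ℝ (Real.exp (-α * t) • T (ξ t))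
        (Real.exp (-α * t) • (T (ξ' t) - α • T (ξ t)))) (α := α) (C := C₁) (s := d * N) (τ := τ)
      hα hC₁nn (by positivity) (fun t => by positivity)
      (by simp [h0, norm_smul, abs_of_pos hd, hN])
      (fun t ht => (hwd t ht).norm_sq) (fun t ht => ?_) ht ?_
    · rw [norm_smul, Real.norm_of_nonneg (Real.exp_pos _).le,
        show 16 * (d * N) ^ 2 = (4 * (d * N)) ^ 2 by ring] at hE
      have h1 := (sq_le_sq₀ (by positivity) (by positivity)).1 hE
      have h2 : ‖T (ξ t)‖ ≤ 4 * (d * N) * Real.exp (α * t) := by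
        calc ‖T (ξ t)‖ = (Real.exp (-α * t) * Real.exp (α * t)) * ‖T (ξ t)‖ := by
              rw [hee, one_mul]
          _ = (Real.exp (-α * t) * ‖T (ξ t)‖) * Real.exp (α * t) := by ring
          _ ≤ _ := by gcongr
      have h3 := (hT (ξ t)).trans h2
      rw [div_mul_eq_mul_div, le_div_iff₀ hc]
      linarith
    · have hrem := (hξ t ht).2
      set x := ξ t
      have h1 : inner ℝ (T x) (T (ξ' t) - α • T x) ≤ C₁ * ‖T x‖ ^ 3 := by
        have h2 : T (ξ' t) - α • T x = T (ξ' t - B x) + (T (B x) - α • T x) := by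
          rw [map_sub]; abel
        have h3 : inner ℝ (T x) (T (B x) - α • T x) ≤ 0 := by
          rw [inner_sub_right, inner_smul_right, real_inner_self_eq_norm_sq]
          linarith [hTB x]
        have h4 : inner ℝ (T x) (T (ξ' t - B x)) ≤ ‖T x‖ * (‖T‖ * (C * ‖x‖ ^ 2)) :=
          (real_inner_le_norm _ _).trans (by
            gcongr
            exact (T.le_opNorm _).trans (by gcongr))
        have h5 : c ^ 2 * ‖x‖ ^ 2 ≤ ‖T x‖ ^ 2 := by
          rw [← mul_pow]; exact pow_le_pow_left₀ (by positivity) (hT x) 2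
        have h6 : ‖x‖ ^ 2 ≤ ‖T x‖ ^ 2 / c ^ 2 := by
          rw [le_div_iff₀ (by positivity)]; linarith
        rw [h2, inner_add_right]
        calc _ ≤ ‖T x‖ * (‖T‖ * (C * ‖x‖ ^ 2)) + 0 := add_le_add h4 h3
          _ ≤ ‖T x‖ * (‖T‖ * (C * (‖T x‖ ^ 2 / c ^ 2))) + 0 := by gcongr
          _ = _ := by rw [hC₁]; field_simp; ring
      have h2 : Real.sqrt (‖Real.exp (-α * t) • T x‖ ^ 2) = Real.exp (-α * t) * ‖T x‖ := by
        rw [Real.sqrt_sq (norm_nonneg _), norm_smul, Real.norm_of_nonneg (Real.exp_pos _).le]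
      rw [h2, inner_smul_left, inner_smul_right]
      simp only [conj_trivial]
      calc 2 * (Real.exp (-α * t) * (Real.exp (-α * t) * inner ℝ (T x) (T (ξ' t) - α • T x)))
          ≤ 2 * (Real.exp (-α * t) * (Real.exp (-α * t) * (C₁ * ‖T x‖ ^ 3))) := by gcongr
        _ = 2 * C₁ * (Real.exp (-α * t) * Real.exp (α * t)) *
            (Real.exp (-α * t) ^ 2 * ‖T x‖ ^ 3) := by rw [hee]; ring
        _ = _ := by ring
    · have h1 := hκ.trans (min_le_left _ _)
      rw [le_div_iff₀ (by positivity)] at h1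
      rw [div_mul_eq_mul_div, div_le_div_iff₀ hα (by positivity)]
      nlinarith [mul_pos (mul_pos hd hTe) (Real.exp_pos (α * t))]
  intro t ht hκ
  refine ⟨hnorm t ht hκ, ?_⟩
  have hmono : MonotoneOn
      (fun t => Real.exp (-α * t) * ℓ (ξ t) + D / α * d ^ 2 * Real.exp (α * t)) (Set.Icc 0 t) := by
    have hder : ∀ s ∈ Set.Icc 0 t, HasDerivAt
        (fun t => Real.exp (-α * t) * ℓ (ξ t) + D / α * d ^ 2 * Real.exp (α * t))
        (Real.exp (-α * s) * (ℓ (ξ' s) - α * ℓ (ξ s)) + D * d ^ 2 * Real.exp (α * s)) s := by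
      intro s hs
      have hs' : s ∈ Set.Ico 0 τ := ⟨hs.1, hs.2.trans_lt ht.2⟩
      refine (((hexp (-α) s).fun_mul (ℓ.hasFDerivAt.comp_hasDerivAt s (hξ s hs').1)).fun_add
        ((hexp α s).const_mul (D / α * d ^ 2))).congr_deriv ?_
      simp only [Function.comp_apply]
      field_simp
      ring
    refine monotoneOn_of_hasDerivWithinAt_nonneg (convex_Icc 0 t)
      (fun s hs => (hder s hs).continuousAt.continuousWithinAt)
      (fun s hs => (hder s (interior_subset hs)).hasDerivWithinAt) fun s hs => ?_
    have hs := interior_subset hs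
    have hs' : s ∈ Set.Ico 0 τ := ⟨hs.1, hs.2.trans_lt ht.2⟩
    have h1 : ‖ξ s‖ ≤ 4 * N / c * (d * Real.exp (α * s)) := by
      refine hnorm s hs' (le_trans ?_ hκ)
      gcongr
      exact hs.2
    have h2 : -(‖ℓ‖ * (C * ‖ξ s‖ ^ 2)) ≤ ℓ (ξ' s) - α * ℓ (ξ s) := by
      rw [← hℓ, ← map_sub]
      have h3 := (ℓ.le_opNorm (ξ' s - B (ξ s))).trans
        (mul_le_mul_of_nonneg_left (hξ s hs').2 (norm_nonneg ℓ))
      exact (abs_le.1 h3).1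
    have h3 : ‖ℓ‖ * (C * ‖ξ s‖ ^ 2) ≤ D * d ^ 2 * Real.exp (α * s) ^ 2 := by
      calc ‖ℓ‖ * (C * ‖ξ s‖ ^ 2) ≤ ‖ℓ‖ * (C * (4 * N / c * (d * Real.exp (α * s))) ^ 2) := by
            gcongr
        _ = _ := by rw [hD]; ring
    have h4 : Real.exp (-α * s) * (D * d ^ 2 * Real.exp (α * s) ^ 2) =
        D * d ^ 2 * Real.exp (α * s) := by
      linear_combination D * d ^ 2 * Real.exp (α * s) * hee s
    have h5 := mul_le_mul_of_nonneg_left h2 (Real.exp_pos (-α * s)).le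
    have h6 := mul_le_mul_of_nonneg_left h3 (Real.exp_pos (-α * s)).le
    linarith
  have h1 := hmono (Set.left_mem_Icc.2 ht.1) (Set.right_mem_Icc.2 ht.1) ht.1
  simp only [h0, map_smul, he, mul_zero, Real.exp_zero, smul_eq_mul, mul_one, one_mul] at h1
  have h2 : D / α * d ^ 2 * Real.exp (α * t) ≤ d / 2 := by
    have h3 := hκ.trans (min_le_right _ _)
    rw [le_div_iff₀ (by positivity)] at h3
    rw [show D / α * d ^ 2 * Real.exp (α * t) = D * d * (d * Real.exp (α * t)) / α by ring,
      div_le_div_iff₀ hα two_pos]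
    have h4 : 0 < d * Real.exp (α * t) := by positivity
    nlinarith
  have h3 : d / 2 ≤ Real.exp (-α * t) * ℓ (ξ t) := by
    have : 0 ≤ D / α * d ^ 2 := by positivity
    linarith
  calc d * Real.exp (α * t) / 2 = d / 2 * Real.exp (α * t) := by ring
    _ ≤ Real.exp (-α * t) * ℓ (ξ t) * Real.exp (α * t) := by gcongr
    _ = ℓ (ξ t) := by linear_combination ℓ (ξ t) * hee t

/-- An equilibrium with a dominant positive eigenvalue is unstable: arbitrarily close to it start
solutions along which the corresponding left eigenvector `ℓ` reaches a fixed size. -/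
lemma exists_escaping_solution [FiniteDimensional ℝ E] {F : E → E} {z : E}
    (hF : ContDiffAt ℝ 2 F z) (hz : F z = 0)
    {T : E →L[ℝ] G} {ℓ : E →L[ℝ] ℝ} {α c : ℝ}
    (hα : 0 < α) (hc : 0 < c) (hT : ∀ v, c * ‖v‖ ≤ ‖T v‖)
    (hTB : ∀ v, inner ℝ (T v) (T (fderiv ℝ F z v)) ≤ α * ‖T v‖ ^ 2)
    (hℓ : ∀ v, ℓ (fderiv ℝ F z v) = α * ℓ v) (hℓ0 : ℓ ≠ 0) {U : Set E} (hU : U ∈ nhds z) :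
    ∃ κ > 0, ∀ δ > 0, ∃ (ζ : ℝ → E) (a b : ℝ), a < 0 ∧ 0 < b ∧
      (∀ t ∈ Set.Ioo a b, ζ t ∈ U ∧ HasDerivAt ζ (F (ζ t)) t) ∧ ‖ζ 0 - z‖ < δ ∧
      ∃ t ∈ Set.Ioo a b, κ ≤ ℓ (ζ t - z) := by
  obtain ⟨F', r, K, L, C, hr, hC, hin, hK, hL, hrem⟩ := exists_cutoff hF hz hU
  obtain ⟨e, he⟩ : ∃ e, ℓ e = 1 := by
    obtain ⟨v, hv⟩ := DFunLike.ne_iff.1 hℓ0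
    have hv' : ℓ v ≠ 0 := hv
    exact ⟨(ℓ v)⁻¹ • v, by rw [map_smul, smul_eq_mul, inv_mul_cancel₀ hv']⟩
  obtain ⟨κ, hκ, A, hA, hgrow⟩ := growth_estimate hα hc hC hT hTB hℓ he
  have he0 : 0 < ‖e‖ := norm_pos_iff.2 fun h0 => by simp [h0] at he
  -- below `m` the growth estimate holds and confines the solution to the ball of radius `r`
  set m := min κ (r / (2 * A))
  have hmpos : 0 < m := by positivity
  refine ⟨m / 4, by positivity, fun δ hδ => ?_⟩
  set d := min (m / 4) (δ / (2 * ‖e‖))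
  have hdpos : 0 < d := by positivity
  have hdm : d ≤ m / 4 := min_le_left _ _
  have hde : d * ‖e‖ < δ := by
    have : d ≤ δ / (2 * ‖e‖) := min_le_right _ _
    rw [le_div_iff₀ (by positivity)] at this
    linarith
  -- the time at which `d e^{α b} = m`
  set b := Real.log (m / d) / α with hb
  have hbe : d * Real.exp (α * b) = m := by
    rw [hb, mul_div_cancel₀ _ hα.ne', Real.exp_log (by positivity)]
    field_simp
  set t₁ := Real.log (m / (2 * d)) / α with ht₁
  have ht₁e : d * Real.exp (α * t₁) = m / 2 := by
    rw [ht₁, mul_div_cancel₀ _ hα.ne', Real.exp_log (by positivity)]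
    field_simp
  have ht₁pos : 0 < t₁ := by
    refine div_pos (Real.log_pos ?_) hα
    rw [lt_div_iff₀ (by positivity)]; linarith
  have ht₁b : t₁ < b := by
    have h1 : Real.exp (α * t₁) < Real.exp (α * b) := by
      refine lt_of_mul_lt_mul_left ?_ hdpos.le
      rw [ht₁e, hbe]; linarith
    exact lt_of_mul_lt_mul_left (Real.exp_lt_exp.1 h1) hα.le
  have hbpos : 0 < b := ht₁pos.trans ht₁b
  obtain ⟨ζ, hζ0, hζ⟩ := exists_solution_of_bounded hK hL (z + d • e) hbpos.le
  have hξ := hgrow d b (fun t => ζ t - z) (fun t => F' (ζ t)) hdpos (by simp [hζ0])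
    (fun t ht => ⟨(hζ t ⟨by linarith [ht.1], ht.2⟩).sub_const z, hrem _⟩)
  have hmle : ∀ t, t < b → d * Real.exp (α * t) ≤ m := fun t ht => by
    rw [← hbe]; gcongr
  have hball : ∀ t ∈ Set.Ico 0 b, ‖ζ t - z‖ < r := by
    intro t ht
    have h1 := (hξ t ht ((hmle t ht.2).trans (min_le_left _ _))).1
    have h2 : A * (d * Real.exp (α * t)) ≤ A * (r / (2 * A)) := by
      gcongr
      exact (hmle t ht.2).trans (min_le_right _ _)
    have h3 : A * (r / (2 * A)) = r / 2 := by field_simp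
    linarith
  have hcont : ContinuousAt (fun t => ‖ζ t - z‖) 0 :=
    ((hζ 0 ⟨by linarith, hbpos⟩).continuousAt.sub continuousAt_const).norm
  obtain ⟨a, ha, hab⟩ := Metric.eventually_nhds_iff_ball.1
    (hcont.eventually_lt continuousAt_const (hball 0 ⟨le_rfl, hbpos⟩))
  refine ⟨ζ, -min a b, b, by have := lt_min ha hbpos; linarith, hbpos, fun t ht => ?_, ?_,
    t₁, ⟨?_, ht₁b⟩, ?_⟩
  · have hta : -a < t ∧ -b < t := by
      have h1 := min_le_left a b
      have h2 := min_le_right a b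
      constructor <;> linarith [ht.1]
    have hb' : ‖ζ t - z‖ < r := by
      rcases le_or_gt 0 t with h0 | h0
      · exact hball t ⟨h0, ht.2⟩
      · exact hab t (by rw [Metric.mem_ball, Real.dist_eq, sub_zero, abs_of_neg h0]; linarith)
    rw [← (hin _ hb').2]
    exact ⟨(hin _ hb').1, hζ t ⟨hta.2, ht.2⟩⟩
  · rw [hζ0, add_sub_cancel_left, norm_smul, Real.norm_of_nonneg hdpos.le]
    exact hde
  · have := lt_min ha hbpos; linarith
  · have h1 := (hξ t₁ ⟨ht₁pos.le, ht₁b⟩ ((hmle t₁ ht₁b).trans (min_le_left _ _))).2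
    rw [ht₁e] at h1
    linarith

end Instability

/-! ### Nonlinear instability -/

/-- The vector field of the equations in the rotating frame, solved for the velocity:
`K M⁻¹ (∇H(z) + ω M z)`. -/
def rotatingField (Γ : Fin n → ℝ) (ω : ℝ) (z : Config n) : Config n :=
  WithLp.toLp 2 ((symplK n * (circMatrix Γ)⁻¹) *ᵥ fun a => hamGrad Γ z a + ω * (Γ a.1 * z a))

lemma contDiffAt_rotatingField (Γ : Fin n → ℝ) (ω : ℝ) {z : Config n} (hz : CollisionFree z)
    {k : WithTop ℕ∞} : ContDiffAt ℝ k (rotatingField Γ ω) z := by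
  rw [contDiffAt_euclidean]
  intro a
  exact ContDiffAt.sum fun b _ => contDiffAt_const.mul ((contDiffAt_hamGrad Γ hz b).add
    (contDiffAt_const.mul (contDiffAt_const.mul (coord b).contDiff.contDiffAt)))

lemma clm_apply_eq_sum (f : Config n →L[ℝ] ℝ) (v : Config n) :
    f v = ∑ a, v a * f (EuclideanSpace.single a 1) := by
  have h : v = ∑ a, v a • EuclideanSpace.single a (1 : ℝ) := by
    ext b
    simp [Finset.sum_apply, Pi.single_apply]
  conv_lhs => rw [h]
  simp

lemma IsNormalForm.fderiv_rotatingField {Γ : Fin n → ℝ} {ω : ℝ} {z : Config n}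
    {T : Matrix (Fin n × Fin 2) (Fin n × Fin 2) ℝ} {μ : Fin n → ℝ} {k₀ k₁ : Fin n}
    (h : IsNormalForm Γ ω z T μ k₀ k₁) (hΓ : ∀ i, 0 < Γ i) (hz : CollisionFree z)
    (v : Config n) :
    (fderiv ℝ (rotatingField Γ ω) z v).ofLp = stabilityMatrix Γ ω z *ᵥ v.ofLp := by
  have hsymm : ∀ a b, hessian (lagrangian Γ ω) z a b = hessian (lagrangian Γ ω) z b a := by
    intro a b
    have : (hessian (lagrangian Γ ω) z)ᵀ = hessian (lagrangian Γ ω) z := by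
      rw [h.hessian_eq, Matrix.transpose_mul, Matrix.transpose_mul, Matrix.diagonal_transpose,
        Matrix.transpose_transpose, Matrix.mul_assoc]
    exact congrFun (congrFun this b) a
  have hg : ∀ b, HasFDerivAt (fun z : Config n => hamGrad Γ z b + ω * (Γ b.1 * z b))
      (fderiv ℝ (fun z => hamGrad Γ z b) z + ω • Γ b.1 • coord b) z := fun b =>
    ((contDiffAt_hamGrad Γ hz b (k := 1)).differentiableAt (by norm_num)).hasFDerivAt.fun_add
      (((hasFDerivAt_coord b z).const_mul (Γ b.1)).const_mul ω)
  have hgv : ∀ b, (fderiv ℝ (fun z => hamGrad Γ z b) z + ω • Γ b.1 • coord b) v =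
      (hessian (lagrangian Γ ω) z *ᵥ v.ofLp) b := by
    intro b
    rw [clm_apply_eq_sum, Matrix.mulVec, dotProduct]
    refine Finset.sum_congr rfl fun a _ => ?_
    rw [hsymm b a, hessian_lagrangian Γ ω hz, Matrix.add_apply, hessian_hamiltonian_apply Γ hz,
      mul_comm]
    by_cases hab : a = b
    · simp [circMatrix, hab]
    · simp [circMatrix, hab, Ne.symm hab]
  funext a
  have h1 : HasFDerivAt (fun z => rotatingField Γ ω z a)
      (∑ b, (symplK n * (circMatrix Γ)⁻¹) a b •
        (fderiv ℝ (fun z => hamGrad Γ z b) z + ω • Γ b.1 • coord b)) z :=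
    HasFDerivAt.fun_sum fun b _ => (hg b).const_mul _
  have h2 := (hasFDerivAt_coord a (rotatingField Γ ω z)).comp z
    ((contDiffAt_rotatingField Γ ω hz (k := 1)).differentiableAt (by norm_num)).hasFDerivAt
  have h3 := congrArg (fun f : Config n →L[ℝ] ℝ => f v) (h2.unique h1)
  simp only [sum_apply, smul_apply, hgv] at h3
  rw [stabilityMatrix_eq hΓ ω hz, ← Matrix.mulVec_mulVec]
  exact h3

lemma symplK_mulVec_zero (y : Fin n × Fin 2 → ℝ) (k : Fin n) :
    (symplK n *ᵥ y) (k, 0) = y (k, 1) := by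
  simp [symplK, symplJ, Matrix.mulVec, dotProduct, Fintype.sum_prod_type, Matrix.one_apply]

lemma symplK_mulVec_one (y : Fin n × Fin 2 → ℝ) (k : Fin n) :
    (symplK n *ᵥ y) (k, 1) = -y (k, 0) := by
  simp [symplK, symplJ, Matrix.mulVec, dotProduct, Fintype.sum_prod_type, Matrix.one_apply]

/-- Each planar mode `y₀' = (ω - μ) y₁`, `y₁' = -(μ + ω) y₀` has a weighted Euclidean norm that
grows at most at the rate `α`. For `μ = ω`, a Jordan block, the weights have to be unbalanced. -/
lemma exists_mode_weights {ω α μ : ℝ} (hα : 0 < α) (hω : 0 < ω)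
    (hμ : μ = 0 ∨ μ = ω ∨ (ω < μ ∧ μ ^ 2 - ω ^ 2 ≤ α ^ 2)) :
    ∃ p q : ℝ, 0 < p ∧ 0 < q ∧ ∀ a b : ℝ,
      p ^ 2 * (a * ((ω - μ) * b)) + q ^ 2 * (b * (-((μ + ω) * a))) ≤
        α * (p ^ 2 * a ^ 2 + q ^ 2 * b ^ 2) := by
  rcases hμ with rfl | rfl | ⟨hlt, hle⟩
  · refine ⟨1, 1, one_pos, one_pos, fun a b => ?_⟩
    have : 0 ≤ α * (a ^ 2 + b ^ 2) := by positivity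
    nlinarith
  · refine ⟨μ / α, 1, by positivity, one_pos, fun a b => ?_⟩
    have h1 : 0 ≤ α * (μ / α * a + b) ^ 2 := by positivity
    have h2 : α * (μ / α * a + b) ^ 2 =
        α * ((μ / α) ^ 2 * a ^ 2 + 1 ^ 2 * b ^ 2) + 2 * (μ * (a * b)) := by
      field_simp; ring
    nlinarith
  · have h1 : 0 < μ + ω := by linarith
    have h2 : 0 < μ - ω := by linarith
    refine ⟨Real.sqrt (μ + ω), Real.sqrt (μ - ω), Real.sqrt_pos.2 h1, Real.sqrt_pos.2 h2,
      fun a b => ?_⟩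
    set p := Real.sqrt (μ + ω)
    set q := Real.sqrt (μ - ω)
    have hp : p ^ 2 = μ + ω := Real.sq_sqrt h1.le
    have hq : q ^ 2 = μ - ω := Real.sq_sqrt h2.le
    have hp0 : 0 < p := Real.sqrt_pos.2 h1
    have hq0 : 0 < q := Real.sqrt_pos.2 h2
    have hpq : p * q ≤ α := by
      refine le_of_sq_le_sq ?_ hα.le
      rw [mul_pow, hp, hq]; linarith
    have h3 : p ^ 2 * (a * ((ω - μ) * b)) + q ^ 2 * (b * (-((μ + ω) * a))) =
        p * q * (-2 * (p * a) * (q * b)) := by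
      rw [show ω - μ = -q ^ 2 by rw [hq]; ring, ← hp]; ring
    have h4 : -2 * (p * a) * (q * b) ≤ (p * a) ^ 2 + (q * b) ^ 2 := by
      nlinarith [sq_nonneg (p * a + q * b)]
    rw [h3]
    calc p * q * (-2 * (p * a) * (q * b)) ≤ p * q * ((p * a) ^ 2 + (q * b) ^ 2) := by gcongr
      _ ≤ α * ((p * a) ^ 2 + (q * b) ^ 2) := by gcongr
      _ = _ := by ring

lemma IsNormalForm.mulVec_stabilityMatrix {Γ : Fin n → ℝ} {ω : ℝ} {z : Config n}
    {T : Matrix (Fin n × Fin 2) (Fin n × Fin 2) ℝ} {μ : Fin n → ℝ} {k₀ k₁ : Fin n}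
    (h : IsNormalForm Γ ω z T μ k₀ k₁) (v : Fin n × Fin 2 → ℝ) (k : Fin n) :
    (T *ᵥ (stabilityMatrix Γ ω z *ᵥ v)) (k, 0) = (ω - μ k) * (T *ᵥ v) (k, 1) ∧
      (T *ᵥ (stabilityMatrix Γ ω z *ᵥ v)) (k, 1) = -((μ k + ω) * (T *ᵥ v) (k, 0)) := by
  rw [Matrix.mulVec_mulVec, h.mul_stabilityMatrix, ← Matrix.mulVec_mulVec, ← Matrix.mulVec_mulVec,
    symplK_mulVec_zero, symplK_mulVec_one, Matrix.mulVec_diagonal, Matrix.mulVec_diagonal]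
  simp [modeCoeff]

/-- The coordinates of the nontrivial modes vanish on the whole circle of rotated configurations. -/
lemma IsNormalForm.mulVec_rotate {Γ : Fin n → ℝ} {ω : ℝ} {z : Config n}
    {T : Matrix (Fin n × Fin 2) (Fin n × Fin 2) ℝ} {μ : Fin n → ℝ} {k₀ k₁ : Fin n}
    (h : IsNormalForm Γ ω z T μ k₀ k₁) (θ : ℝ) {k : Fin n} (hk : k ≠ k₁) (s : Fin 2) :
    (T *ᵥ (rotate θ z).ofLp) (k, s) = 0 := by
  have h1 : T *ᵥ (rotate θ z).ofLp = Real.cos θ • (T *ᵥ z.ofLp) +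
      Real.sin θ • (symplK n *ᵥ (T *ᵥ z.ofLp)) := by
    rw [rotate, Matrix.mulVec_add, Matrix.mulVec_smul, Matrix.mulVec_smul, Matrix.mulVec_mulVec,
      Matrix.mulVec_mulVec, h.mul_symplK]
  rw [h1, Pi.add_apply, Pi.smul_apply, Pi.smul_apply, h.mulVec_eq_zero k s hk]
  fin_cases s
  · simp [symplK_mulVec_zero, h.mulVec_eq_zero k 1 hk]
  · simp [symplK_mulVec_one, h.mulVec_eq_zero k 0 hk]

/-- The left eigenvector of the fastest growing mode vanishes on the circle of rotated
configurations, so its growth along a solution is growth of the distance to that circle. -/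
lemma IsNormalForm.not_isNonlinearlyStable {Γ : Fin n → ℝ} {ω : ℝ} {z : Config n}
    {T : Matrix (Fin n × Fin 2) (Fin n × Fin 2) ℝ} {μ : Fin n → ℝ} {k₀ k₁ : Fin n}
    (h : IsNormalForm Γ ω z T μ k₀ k₁) (hΓ : ∀ i, 0 < Γ i) (hz : IsRelativeEquilibrium Γ ω z)
    (hn : 3 ≤ n) : ¬ IsNonlinearlyStable Γ ω z := by
  have hω := h.omega_pos
  have hcf := hz.collisionFree
  have hne : Nonempty (NontrivialMode k₀ k₁) := by
    rw [← Fintype.card_pos_iff, card_nontrivialMode h.ne]; omega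
  obtain ⟨k, hkmax⟩ := Finite.exists_max fun k : NontrivialMode k₀ k₁ => μ k
  have hk := h.lt_mu k k.2.1 k.2.2
  have hp : 0 < μ k + ω := by linarith
  have hq : 0 < μ k - ω := by linarith
  set p := Real.sqrt (μ k + ω)
  set q := Real.sqrt (μ k - ω)
  have hp0 : 0 < p := Real.sqrt_pos.2 hp
  have hq0 : 0 < q := Real.sqrt_pos.2 hq
  have hpp : p ^ 2 = μ k + ω := Real.sq_sqrt hp.le
  have hqq : q ^ 2 = μ k - ω := Real.sq_sqrt hq.le
  have hα : 0 < p * q := mul_pos hp0 hq0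
  have hcase : ∀ l, μ l = 0 ∨ μ l = ω ∨ (ω < μ l ∧ μ l ^ 2 - ω ^ 2 ≤ (p * q) ^ 2) := by
    intro l
    by_cases h0 : l = k₀
    · exact Or.inl (h0 ▸ h.mu_translation)
    by_cases h1 : l = k₁
    · exact Or.inr (Or.inl (h1 ▸ h.mu_rotation))
    have h2 := h.lt_mu l h0 h1
    have h3 : μ l ≤ μ k := hkmax ⟨l, h0, h1⟩
    refine Or.inr (Or.inr ⟨h2, ?_⟩)
    rw [mul_pow, hpp, hqq]
    nlinarith
  choose c₀ c₁ hc₀ hc₁ hc using fun l => exists_mode_weights hα hω (hcase l)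
  set s : Fin n × Fin 2 → ℝ := fun a => if a.2 = 0 then c₀ a.1 else c₁ a.1 with hs
  have hs0 : ∀ a, s a ≠ 0 := fun a => by
    simp only [hs]
    split_ifs
    · exact (hc₀ _).ne'
    · exact (hc₁ _).ne'
  have hunit : IsUnit (Matrix.diagonal s * T).det := by
    rw [Matrix.det_mul, Matrix.det_diagonal]
    exact (isUnit_iff_ne_zero.2 (Finset.prod_ne_zero_iff.2 fun a _ => hs0 a)).mul h.isUnit_det
  let S : Config n →L[ℝ] Config n := Matrix.toEuclideanCLM (𝕜 := ℝ) (Matrix.diagonal s * T)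
  let S' : Config n →L[ℝ] Config n := Matrix.toEuclideanCLM (𝕜 := ℝ) (Matrix.diagonal s * T)⁻¹
  have hSv : ∀ v a, S v a = s a * (T *ᵥ v.ofLp) a := by
    intro v a
    have h1 : (S v).ofLp = (Matrix.diagonal s * T) *ᵥ v.ofLp := Matrix.ofLp_toEuclideanCLM _ _
    rw [h1, ← Matrix.mulVec_mulVec, Matrix.mulVec_diagonal]
  have hSS : ∀ v, S' (S v) = v := by
    intro v
    have h1 : (S' (S v)).ofLp =
        (Matrix.diagonal s * T)⁻¹ *ᵥ ((Matrix.diagonal s * T) *ᵥ v.ofLp) := by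
      rw [← Matrix.ofLp_toEuclideanCLM, ← Matrix.ofLp_toEuclideanCLM]
    rw [Matrix.mulVec_mulVec, Matrix.nonsing_inv_mul _ hunit, Matrix.one_mulVec] at h1
    exact WithLp.ofLp_injective 2 h1
  have hSlow : ∀ v, (‖S'‖ + 1)⁻¹ * ‖v‖ ≤ ‖S v‖ := by
    intro v
    rw [inv_mul_le_iff₀ (by positivity)]
    have h1 := S'.le_opNorm (S v)
    rw [hSS] at h1
    nlinarith [norm_nonneg (S v)]
  let ℓ : Config n →L[ℝ] ℝ :=
    (p / s (k, 0)) • ((coord (k.1, 0)).comp S) - (q / s (k, 1)) • ((coord (k.1, 1)).comp S)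
  have hℓv : ∀ v, ℓ v = p * (T *ᵥ v.ofLp) (k, 0) - q * (T *ᵥ v.ofLp) (k, 1) := by
    intro v
    have h1 : ℓ v = p / s (k, 0) * S v (k, 0) - q / s (k, 1) * S v (k, 1) := rfl
    rw [h1, hSv, hSv]
    have := hs0 (k, 0)
    have := hs0 (k, 1)
    field_simp
  have hDF := h.fderiv_rotatingField hΓ hcf
  have hST : ∀ v, inner ℝ (S v) (S (fderiv ℝ (rotatingField Γ ω) z v)) ≤ p * q * ‖S v‖ ^ 2 := by
    intro v
    rw [EuclideanSpace.norm_sq_eq, PiLp.inner_apply, Fintype.sum_prod_type, Fintype.sum_prod_type,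
      Finset.mul_sum]
    refine Finset.sum_le_sum fun l _ => ?_
    obtain ⟨h1, h2⟩ := h.mulVec_stabilityMatrix v.ofLp l
    have h3 := hc l ((T *ᵥ v.ofLp) (l, 0)) ((T *ᵥ v.ofLp) (l, 1))
    simp only [Fin.sum_univ_two, hSv, hDF, h1, h2, Real.norm_eq_abs, sq_abs]
    simp only [hs, if_true, one_ne_zero, if_false, RCLike.inner_apply, conj_trivial]
    linarith
  have hℓB : ∀ v, ℓ (fderiv ℝ (rotatingField Γ ω) z v) = p * q * ℓ v := by
    intro v
    obtain ⟨h1, h2⟩ := h.mulVec_stabilityMatrix v.ofLp k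
    rw [hℓv, hℓv, hDF, h1, h2]
    rw [show ω - μ k = -q ^ 2 by rw [hqq]; ring, ← hpp]
    ring
  have hℓ0 : ℓ ≠ 0 := by
    intro h0
    have h1 := hℓv (WithLp.toLp 2 (T⁻¹ *ᵥ Pi.single (k.1, 0) 1))
    rw [h0] at h1
    simp only [Matrix.mulVec_mulVec, Matrix.mul_nonsing_inv _ h.isUnit_det,
      Matrix.one_mulVec] at h1
    simp [hp0.ne] at h1
  have hF0 : rotatingField Γ ω z = 0 := by
    have : (fun a => hamGrad Γ z a + ω * (Γ a.1 * z a)) = 0 := by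
      funext a; rw [hz.hamGrad_eq, neg_add_cancel, Pi.zero_apply]
    rw [rotatingField, this, Matrix.mulVec_zero, WithLp.toLp_zero]
  obtain ⟨κ, hκ, hesc⟩ := exists_escaping_solution (contDiffAt_rotatingField Γ ω hcf) hF0 hα
    (by positivity) hSlow hST hℓB hℓ0 (isOpen_setOf_collisionFree.mem_nhds hcf)
  have hℓn : 0 < ‖ℓ‖ := norm_pos_iff.2 hℓ0
  intro hstab
  obtain ⟨δ, hδ, hst⟩ := hstab (κ / ‖ℓ‖) (by positivity)
  obtain ⟨ζ, a, b, ha, hb, hsol, hζ0, t, ht, hκt⟩ := hesc δ hδ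
  have hrot : IsRotatingSolutionOn Γ ω ζ (Set.Ioo a b) := by
    intro t ht
    obtain ⟨hcft, hder⟩ := hsol t ht
    refine ⟨hcft, _, hder, ?_⟩
    have hM : circMatrix Γ * (symplK n * (circMatrix Γ)⁻¹) = symplK n := by
      rw [← Matrix.mul_assoc, circMatrix_mul_symplK, Matrix.mul_assoc,
        Matrix.mul_nonsing_inv _ (isUnit_det_circMatrix hΓ), Matrix.mul_one]
    rw [rotatingField, Matrix.mulVec_mulVec, hM, gradient_hamiltonian Γ hcft]
    congr 1
    funext a
    simp [circMatrix_mulVec]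
  refine absurd (hst ζ a b ha hb hrot hζ0 t ht) (not_lt.2 ?_)
  refine (Metric.le_infDist (Set.range_nonempty _)).2 ?_
  rintro _ ⟨θ, rfl⟩
  have hℓz : ∀ θ, ℓ (rotate θ z) = 0 := fun θ => by
    rw [hℓv, h.mulVec_rotate θ k.2.2, h.mulVec_rotate θ k.2.2]; ring
  have h1 : ℓ (ζ t - z) = ℓ (ζ t - rotate θ z) := by
    have h2 := hℓz 0
    rw [rotate_zero] at h2
    rw [map_sub, map_sub, h2, hℓz]
  rw [div_le_iff₀ hℓn, dist_eq_norm, mul_comm]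
  exact (hκt.trans_eq h1).trans ((le_abs_self _).trans (ℓ.le_opNorm _))

lemma not_isSpectrallyStable_of_real_eigenvalues {Γ : Fin n → ℝ} {ω : ℝ} {z : Config n}
    {m : ℕ} {α : Fin m → ℝ} (hm : 0 < m) (hα : ∀ j, 0 < α j)
    (h : nontrivialEigenvalues Γ ω z = ∑ j, ({(α j : ℂ), -(α j : ℂ)} : Multiset ℂ)) :
    ¬ IsSpectrallyStable Γ ω z := by
  intro hst
  have h1 := hst.2 (α ⟨0, hm⟩ : ℂ) (by
    rw [h, Multiset.mem_sum]
    exact ⟨⟨0, hm⟩, Finset.mem_univ _, by simp⟩)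
  exact (hα ⟨0, hm⟩).ne' (by simpa using h1)

lemma IsRelativeEquilibrium.gradient_add_eq_zero {Γ : Fin n → ℝ} {ω : ℝ} {z : Config n}
    (h : IsRelativeEquilibrium Γ ω z) :
    gradient (hamiltonian Γ) z + ω • gradient (angularImpulse Γ) z = 0 := by
  ext a
  rw [PiLp.add_apply, PiLp.smul_apply, gradient_apply, gradient_apply,
    fderiv_hamiltonian_single Γ h.collisionFree, fderiv_angularImpulse_single, h.hamGrad_eq]
  simp

end PointVortex

end

theorem mainTheorem5 (n : ℕ) (hn : 2 ≤ n) (Γ : Fin n → ℝ) (hΓ : ∀ i, 0 < Γ i) (ω : ℝ)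
    (z₀ : PointVortex.Config n) (hz₀ : PointVortex.IsRelativeEquilibrium Γ ω z₀)
    (hcol : PointVortex.IsCollinear z₀) :
    (gradient (PointVortex.hamiltonian Γ) z₀ + ω • gradient (PointVortex.angularImpulse Γ) z₀ = 0 ∧
      PointVortex.morseIndex Γ ω z₀ = n - 2) ∧
    (∃ α : Fin (n - 2) → ℝ, (∀ j, 0 < α j) ∧
      PointVortex.nontrivialEigenvalues Γ ω z₀ =
        ∑ j, ({(α j : ℂ), -(α j : ℂ)} : Multiset ℂ)) ∧
    (3 ≤ n → ¬ PointVortex.IsSpectrallyStable Γ ω z₀ ∧ ¬ PointVortex.IsLinearlyStable Γ ω z₀ ∧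
      ¬ PointVortex.IsNonlinearlyStable Γ ω z₀) := by
  obtain ⟨T, μ, k₀, k₁, h⟩ := hz₀.exists_isNormalForm hΓ hn hcol
  obtain ⟨α, hα, heig⟩ := h.nontrivialEigenvalues_eq
  refine ⟨⟨hz₀.gradient_add_eq_zero, h.morseIndex_eq⟩, ⟨α, hα, heig⟩, fun hn3 => ?_⟩
  have hspec := PointVortex.not_isSpectrallyStable_of_real_eigenvalues (by omega) hα heig
  exact ⟨hspec, fun hlin => hspec hlin.1, h.not_isNonlinearlyStable hΓ hz₀ hn3⟩
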